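/- Let $n,k$ be integers with $k\ge 4$ and $n>2k$, and write $[n]=\{1,\dots,n\}$, $[a,b]=\{a,a+1,\dots,b\}$, and $\binom{[n]}{k}$ for the collection of all $k$-element subsets of $[n]$. For a family $\mathcal F\subset\binom{[n]}{k}$ let $\gamma(\mathcal F)=|\mathcal F|-\Delta(\mathcal F)$ be its diversity, where $\Delta(\mathcal F)$ is the maximum over $i\in[n]$ of the number of sets in $\mathcal F$ that contain $i$. Put $I_i=[i+1,k+i]$ and $$\mathcal J_2=\{I_1,I_2\}\cup\Big\{F\in\binom{[n]}{k}: 1\in F,\ F\cap I_1\neq\emptyset,\ F\cap I_2\neq\emptyset\Big\}.$$ **Theorem.** Let $\mathcal F\subset\binom{[n]}{k}$ be an intersecting family (any two of its sets intersect) with $\gamma(\mathcal F)\ge 2$. Then $$|\mathcal F|\le\binom{n-1}{k-1}-\binom{n-k-1}{k-1}-\binom{n-k-2}{k-2}+2 .$$ Moreover, if $k\ge 5$, then equality holds if and only if $\mathcal F$ is isomorphic to $\mathcal J_2$, that is, some permutation of $[n]$ carries $\mathcal F$ to $\mathcal J_2$. -/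

import Mathlib

/-- The degree of `i` in `F`: the number of members of `F` that contain `i`. -/
def familyDegree {n : ℕ} (F : Finset (Finset (Fin n))) (i : Fin n) : ℕ :=
  (F.filter (fun A => i ∈ A)).card

/-- The maximal degree of an element of the ground set in `F`. -/
def familyMaxDegree {n : ℕ} (F : Finset (Finset (Fin n))) : ℕ :=
  Finset.univ.sup (familyDegree F)

/-- The diversity of `F`: its size minus its maximal degree (which never exceeds the size, so that
the subtraction does not truncate). -/
def diversity {n : ℕ} (F : Finset (Finset (Fin n))) : ℕ :=
  F.card - familyMaxDegree F

/-- The interval `[a, b]` of the ground set `[n] = {1, …, n}`; the element `x : Fin n` stands for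
the number `x + 1` of `[n]`. -/
def groundInterval (n a b : ℕ) : Finset (Fin n) :=
  Finset.univ.filter (fun x => a ≤ (x : ℕ) + 1 ∧ (x : ℕ) + 1 ≤ b)

/-- The `k`-set `I_i = [i + 1, k + i]`. -/
def intervalSet (n k i : ℕ) : Finset (Fin n) :=
  groundInterval n (i + 1) (k + i)

/-- The family `J_i`: the sets `I_1` and `I_i` together with all `k`-sets that contain the first
element of the ground set and meet both `I_1` and `I_i`. -/
def familyJ (n k i : ℕ) : Finset (Finset (Fin n)) :=
  {intervalSet n k 1, intervalSet n k i} ∪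
    (Finset.powersetCard k (Finset.univ : Finset (Fin n))).filter (fun A =>
      (∃ x ∈ A, (x : ℕ) + 1 = 1) ∧
        (A ∩ intervalSet n k 1).Nonempty ∧ (A ∩ intervalSet n k i).Nonempty)

/-- Two families on the same ground set are isomorphic if a permutation of the ground set carries
one to the other. -/
def FamilyIsomorphic {n : ℕ} (F G : Finset (Finset (Fin n))) : Prop :=
  ∃ σ : Equiv.Perm (Fin n), F.image (fun A => A.image σ) = G

/-! Diversity at least 2 means that every point is avoided by at least two members. Suppose some
point `c` is avoided by exactly two, `G₁` and `G₂`. All other members contain `c` and meet both. Fix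
`t ∈ G₁ \ G₂`: the sets through `c` that miss `G₁`, and those through `c` and `t` that miss `G₂`,
are excluded and distinct, which gives the bound. Equality forces `#(G₁ \ G₂) = 1`; a permutation
then carries `F` into `familyJ n k 2`, and equal cardinalities finish.

Otherwise every point is avoided by at least three members, and the bound is to be shown, strictly
for `k ≥ 5`. Apply shifts `i ← j`, `i < j`, as long as this property survives. If it survives
throughout, the final family is shifted and induction on the ground set applies
(`IsShiftedOn.card_add_choose_add_choose_le`): members avoiding the largest point `a` fall under
induction. The links at `a` of the members through `a` again form an intersecting family; they
either all contain the smallest point, and are counted by the sets they must meet, or obey the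
Hilton–Milner bound. If a shift `i ← j` destroys the property, at most two members avoid both `i`
and `j`. The family splits by its trace on `{i, j}`; the members containing exactly one of the two
points form a cross-intersecting pair, bounded by shifting in the same way
(`card_add_choose_add_choose_le_of_pair`). -/

open Finset

/-! ### Counting sets that must meet one, two or three given sets. -/

section Counting

variable {α : Type*} [DecidableEq α]

/-- Two families cross-intersect if every member of the first meets every member of the second. -/
def CrossIntersecting (A B : Finset (Finset α)) : Prop :=
  ∀ X ∈ A, ∀ Y ∈ B, (X ∩ Y).Nonempty

theorem CrossIntersecting.symm {A B : Finset (Finset α)} (h : CrossIntersecting A B) :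
    CrossIntersecting B A :=
  fun X hX Y hY => by rw [inter_comm]; exact h Y hY X hX

theorem CrossIntersecting.mono {A B A' B' : Finset (Finset α)} (h : CrossIntersecting A B)
    (hA : A' ⊆ A) (hB : B' ⊆ B) : CrossIntersecting A' B' :=
  fun X hX Y hY => h X (hA hX) Y (hB hY)

theorem card_add_choose_le_of_meets {S T : Finset α} {H : Finset (Finset α)} {i : ℕ}
    (hH : H ⊆ powersetCard i S) (hT : ∀ X ∈ H, (X ∩ T).Nonempty) :
    #H + (#S - #T).choose i ≤ (#S).choose i := by
  have h1 : Disjoint H (powersetCard i (S \ T)) := by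
    rw [disjoint_left]
    intro X hX hX'
    obtain ⟨x, hx⟩ := hT X hX
    have := (mem_powersetCard.1 hX').1 (mem_inter.1 hx).1
    exact (mem_sdiff.1 this).2 (mem_inter.1 hx).2
  have h2 : H ∪ powersetCard i (S \ T) ⊆ powersetCard i S :=
    union_subset hH (powersetCard_mono sdiff_subset)
  have h3 := card_le_card h2
  rw [card_union_of_disjoint h1, card_powersetCard, card_powersetCard] at h3
  have h4 := Nat.choose_le_choose i (le_card_sdiff T S)
  omega

theorem card_filter_mem_powersetCard_succ {U : Finset α} {t : α} (ht : t ∈ U) (i : ℕ) :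
    #((powersetCard (i + 1) U).filter (t ∈ ·)) = (#U - 1).choose i := by
  have : (powersetCard (i + 1) U).filter (t ∈ ·) =
      (powersetCard i (U.erase t)).image (insert t) := by
    ext X
    simp only [mem_filter, mem_powersetCard, mem_image]
    constructor
    · rintro ⟨⟨h1, h2⟩, h3⟩
      exact ⟨X.erase t, ⟨erase_subset_erase t h1, by rw [card_erase_of_mem h3, h2]; rfl⟩,
        insert_erase h3⟩
    · rintro ⟨Y, ⟨h1, h2⟩, rfl⟩
      have htY : t ∉ Y := fun h => notMem_erase t U (h1 h)
      exact ⟨⟨insert_subset ht (h1.trans (erase_subset _ _)),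
        by rw [card_insert_of_notMem htY, h2]⟩, mem_insert_self _ _⟩
  rw [this, card_image_of_injOn, card_powersetCard, card_erase_of_mem ht]
  intro X hX Y hY hXY
  have hX' : t ∉ X := fun h => notMem_erase t U ((mem_powersetCard.1 hX).1 h)
  have hY' : t ∉ Y := fun h => notMem_erase t U ((mem_powersetCard.1 hY).1 h)
  rw [← erase_insert hX', ← erase_insert hY']
  exact congrArg (fun Z => Z.erase t) hXY

/-- The sets of size `i + 1` that avoid `T₁`, and those that contain `t` and avoid `T₂`, are
disjoint from `H`. -/
theorem card_add_choose_add_choose_le_of_mem {S T₁ T₂ : Finset α} {H : Finset (Finset α)} {i : ℕ}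
    {t : α} (hH : H ⊆ powersetCard (i + 1) S) (ht : t ∈ S) (h1 : t ∈ T₁) (h2 : t ∉ T₂)
    (h : ∀ X ∈ H, (X ∩ T₁).Nonempty ∧ (t ∈ X → (X ∩ T₂).Nonempty)) :
    #H + (#S - #T₁).choose (i + 1) + (#S - #T₂ - 1).choose i ≤ (#S).choose (i + 1) := by
  -- Members of `Q` contain `t ∈ T₁`, so none of them is among the sets avoiding `T₁`: the two
  -- excluded classes are counted without overlap.
  set Q := (powersetCard (i + 1) (S \ T₂)).filter (t ∈ ·) with hQ
  have hd1 : Disjoint Q (powersetCard (i + 1) (S \ T₁)) := by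
    rw [disjoint_left]
    intro X hX hX'
    exact (mem_sdiff.1 ((mem_powersetCard.1 hX').1 (mem_filter.1 hX).2)).2 h1
  have hd2 : Disjoint H Q := by
    rw [disjoint_left]
    intro X hX hX'
    obtain ⟨x, hx⟩ := (h X hX).2 (mem_filter.1 hX').2
    exact (mem_sdiff.1 ((mem_powersetCard.1 (mem_filter.1 hX').1).1 (mem_inter.1 hx).1)).2
      (mem_inter.1 hx).2
  have hQs : Q ⊆ powersetCard (i + 1) S :=
    (filter_subset _ _).trans (powersetCard_mono sdiff_subset)
  have hd3 : Disjoint H (powersetCard (i + 1) (S \ T₁)) := by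
    rw [disjoint_left]
    intro X hX hX'
    obtain ⟨x, hx⟩ := (h X hX).1
    exact (mem_sdiff.1 ((mem_powersetCard.1 hX').1 (mem_inter.1 hx).1)).2 (mem_inter.1 hx).2
  have hsub : (H ∪ Q) ∪ powersetCard (i + 1) (S \ T₁) ⊆ powersetCard (i + 1) S :=
    union_subset (union_subset hH hQs) (powersetCard_mono sdiff_subset)
  have hc := card_le_card hsub
  rw [card_union_of_disjoint (disjoint_union_left.2 ⟨hd3, hd1⟩), card_union_of_disjoint hd2,
    card_powersetCard, card_powersetCard,
    hQ, card_filter_mem_powersetCard_succ (mem_sdiff.2 ⟨ht, h2⟩)] at hc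
  have h4 := Nat.choose_le_choose (i + 1) (le_card_sdiff T₁ S)
  have h5 := Nat.choose_le_choose i (Nat.sub_le_sub_right (le_card_sdiff T₂ S) 1)
  omega

theorem exists_mem_notMem_of_card_eq {T₁ T₂ : Finset α} (hne : T₁ ≠ T₂) (hc : #T₁ = #T₂) :
    ∃ t ∈ T₁, t ∉ T₂ := by
  by_contra! hcon
  exact hne (eq_of_subset_of_card_le hcon hc.ge)

theorem card_add_choose_add_choose_le_of_meets {S T₁ T₂ : Finset α} {H : Finset (Finset α)}
    {i l : ℕ} (hH : H ⊆ powersetCard (i + 1) S) (hT₁ : T₁ ∈ powersetCard l S)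
    (hT₂ : T₂ ∈ powersetCard l S) (hne : T₁ ≠ T₂)
    (h₁ : ∀ X ∈ H, (X ∩ T₁).Nonempty) (h₂ : ∀ X ∈ H, (X ∩ T₂).Nonempty) :
    #H + (#S - l).choose (i + 1) + (#S - l - 1).choose i ≤ (#S).choose (i + 1) := by
  rw [mem_powersetCard] at hT₁ hT₂
  obtain ⟨t, ht1, ht2⟩ := exists_mem_notMem_of_card_eq hne (hT₁.2.trans hT₂.2.symm)
  have := card_add_choose_add_choose_le_of_mem hH (hT₁.1 ht1) ht1 ht2
    fun X hX => ⟨h₁ X hX, fun _ => h₂ X hX⟩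
  rwa [hT₁.2, hT₂.2] at this

/-- A third set costs at least one more member: some `Z` meets `T₁` and `T₂` but misses `T₃`. It
lies outside `H`, yet the bound for two sets still applies to `insert Z H`. -/
theorem card_add_choose_add_choose_lt_of_meets {S T₁ T₂ T₃ : Finset α} {H : Finset (Finset α)}
    {i l : ℕ} (hH : H ⊆ powersetCard (i + 2) S) (hT₁ : T₁ ∈ powersetCard l S)
    (hT₂ : T₂ ∈ powersetCard l S) (hT₃ : T₃ ∈ powersetCard l S) (h12 : T₁ ≠ T₂) (h13 : T₁ ≠ T₃)
    (h23 : T₂ ≠ T₃) (hS : l + (i + 2) ≤ #S)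
    (h₁ : ∀ X ∈ H, (X ∩ T₁).Nonempty) (h₂ : ∀ X ∈ H, (X ∩ T₂).Nonempty)
    (h₃ : ∀ X ∈ H, (X ∩ T₃).Nonempty) :
    #H + (#S - l).choose (i + 2) + (#S - l - 1).choose (i + 1) < (#S).choose (i + 2) := by
  have hT₁' := hT₁
  have hT₂' := hT₂
  rw [mem_powersetCard] at hT₁ hT₂ hT₃
  obtain ⟨x, hx1, hx3⟩ := exists_mem_notMem_of_card_eq h13 (hT₁.2.trans hT₃.2.symm)
  obtain ⟨y, hy2, hy3⟩ := exists_mem_notMem_of_card_eq h23 (hT₂.2.trans hT₃.2.symm)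
  have hxy : ({x, y} : Finset α) ⊆ S \ T₃ := by
    intro z hz
    rcases mem_insert.1 hz with rfl | hz
    · exact mem_sdiff.2 ⟨hT₁.1 hx1, hx3⟩
    · rw [mem_singleton.1 hz]; exact mem_sdiff.2 ⟨hT₂.1 hy2, hy3⟩
  have hcard : i + 2 ≤ #(S \ T₃) := by
    have := le_card_sdiff T₃ S
    omega
  obtain ⟨Z, hZ1, hZ2, hZ3⟩ := exists_subsuperset_card_eq hxy (card_le_two.trans (by omega)) hcard
  have hZH : Z ∉ H := by
    intro hZ
    obtain ⟨z, hz⟩ := h₃ Z hZ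
    exact (mem_sdiff.1 (hZ2 (mem_inter.1 hz).1)).2 (mem_inter.1 hz).2
  have : #(insert Z H) + (#S - l).choose (i + 2) + (#S - l - 1).choose (i + 1) ≤
      (#S).choose (i + 2) := card_add_choose_add_choose_le_of_meets
    (insert_subset (mem_powersetCard.2 ⟨hZ2.trans sdiff_subset, hZ3⟩) hH) hT₁' hT₂' h12
    (forall_mem_insert _ _ _ |>.2 ⟨⟨x, mem_inter.2 ⟨hZ1 (by simp), hx1⟩⟩, h₁⟩)
    (forall_mem_insert _ _ _ |>.2 ⟨⟨y, mem_inter.2 ⟨hZ1 (by simp), hy2⟩⟩, h₂⟩)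
  rw [card_insert_of_notMem hZH] at this
  omega

/-- At most one set of each complementary pair `X`, `S \ X` occurs: `X` in `A` or `S \ X` in `B`. -/
theorem CrossIntersecting.card_add_card_le {S : Finset α} {A B : Finset (Finset α)} {l : ℕ}
    (h : CrossIntersecting A B) (hA : A ⊆ powersetCard l S) (hB : B ⊆ powersetCard l S)
    (hS : #S = 2 * l) : #A + #B ≤ (2 * l).choose l := by
  have hinj : Set.InjOn (fun X => S \ X) (B : Set (Finset α)) := by
    intro X hX Y hY hXY
    rw [← Finset.sdiff_sdiff_eq_self (mem_powersetCard.1 (hB hX)).1,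
      ← Finset.sdiff_sdiff_eq_self (mem_powersetCard.1 (hB hY)).1]
    exact congrArg (fun Z => S \ Z) hXY
  have hd : Disjoint A (B.image (fun X => S \ X)) := by
    rw [disjoint_left]
    intro X hX hX'
    obtain ⟨Y, hY, rfl⟩ := mem_image.1 hX'
    obtain ⟨z, hz⟩ := h _ hX Y hY
    exact (mem_sdiff.1 (mem_inter.1 hz).1).2 (mem_inter.1 hz).2
  have hsub : A ∪ B.image (fun X => S \ X) ⊆ powersetCard l S := by
    refine union_subset hA fun X hX => ?_
    obtain ⟨Y, hY, rfl⟩ := mem_image.1 hX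
    have := mem_powersetCard.1 (hB hY)
    rw [mem_powersetCard, card_sdiff_of_subset this.1]
    exact ⟨sdiff_subset, by omega⟩
  have hc := card_le_card hsub
  rwa [card_union_of_disjoint hd, card_image_of_injOn hinj, card_powersetCard, hS] at hc

theorem CrossIntersecting.card_self_le {S : Finset α} {F : Finset (Finset α)} {m : ℕ}
    (h : CrossIntersecting F F) (hF : F ⊆ powersetCard (m + 1) S) (hS : #S = 2 * (m + 1)) :
    #F ≤ (2 * m + 1).choose m := by
  have h1 := h.card_add_card_le hF hF hS
  have h2 : (2 * (m + 1)).choose (m + 1) = (2 * m + 1).choose m + (2 * m + 1).choose (m + 1) := rfl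
  have h3 := Nat.choose_symm_half m
  omega

end Counting

/-! ### Shifted families, and nonempty shifted cross-intersecting pairs. -/

section Shifted

variable {α : Type*} [LinearOrder α]

/-- `F` is closed under replacing an element `j` of a member by a smaller element `i` of `S`. -/
def IsShiftedOn (S : Finset α) (F : Finset (Finset α)) : Prop :=
  ∀ X ∈ F, ∀ j ∈ X, ∀ i ∈ S, i < j → i ∉ X → insert i (X.erase j) ∈ F

variable {S : Finset α} {A B F : Finset (Finset α)} {a : α} {l m : ℕ}

theorem memberSubfamily_subset_powersetCard
    (hA : A ⊆ powersetCard (l + 1) (insert a S)) : A.memberSubfamily a ⊆ powersetCard l S := by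
  intro X hX
  obtain ⟨h1, h2⟩ := mem_memberSubfamily.1 hX
  obtain ⟨h3, h4⟩ := mem_powersetCard.1 (hA h1)
  rw [card_insert_of_notMem h2] at h4
  exact mem_powersetCard.2 ⟨(insert_subset_insert_iff h2).1 h3, by omega⟩

theorem nonMemberSubfamily_subset_powersetCard
    (hA : A ⊆ powersetCard l (insert a S)) : A.nonMemberSubfamily a ⊆ powersetCard l S := by
  intro X hX
  obtain ⟨h1, h2⟩ := mem_nonMemberSubfamily.1 hX
  obtain ⟨h3, h4⟩ := mem_powersetCard.1 (hA h1)
  exact mem_powersetCard.2 ⟨(subset_insert_iff_of_notMem h2).1 h3, h4⟩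

theorem nonMemberSubfamily_subset : A.nonMemberSubfamily a ⊆ A := filter_subset _ _

theorem IsShiftedOn.nonMemberSubfamily (haS : a ∉ S) (hA : IsShiftedOn (insert a S) A) :
    IsShiftedOn S (A.nonMemberSubfamily a) := by
  intro X hX j hj i hi hij hiX
  obtain ⟨h1, h2⟩ := mem_nonMemberSubfamily.1 hX
  refine mem_nonMemberSubfamily.2 ⟨hA X h1 j hj i (mem_insert_of_mem hi) hij hiX, ?_⟩
  rw [mem_insert, mem_erase]
  rintro (rfl | h)
  · exact haS hi
  · exact h2 h.2

theorem IsShiftedOn.memberSubfamily (haS : a ∉ S) (hA : IsShiftedOn (insert a S) A) :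
    IsShiftedOn S (A.memberSubfamily a) := by
  intro X hX j hj i hi hij hiX
  obtain ⟨h1, h2⟩ := mem_memberSubfamily.1 hX
  have hia : i ≠ a := fun h => haS (h ▸ hi)
  have hja : a ≠ j := fun h => h2 (h ▸ hj)
  have := hA _ h1 j (mem_insert_of_mem hj) i (mem_insert_of_mem hi) hij
    (by simp [hia, hiX])
  rw [erase_insert_of_ne hja, insert_comm] at this
  refine mem_memberSubfamily.2 ⟨this, ?_⟩
  simp [hia.symm, h2]

theorem IsShiftedOn.nonMemberSubfamily_erase {c : α} (hA : IsShiftedOn S A) :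
    IsShiftedOn (S.erase c) (A.nonMemberSubfamily c) := by
  intro X hX j hj i hi hij hiX
  obtain ⟨h1, h2⟩ := mem_nonMemberSubfamily.1 hX
  refine mem_nonMemberSubfamily.2 ⟨hA X h1 j hj i (mem_of_mem_erase hi) hij hiX, ?_⟩
  rw [mem_insert, mem_erase]
  rintro (rfl | h)
  · exact notMem_erase c S hi
  · exact h2 h.2

theorem CrossIntersecting.member_nonMember (h : CrossIntersecting A B) :
    CrossIntersecting (A.memberSubfamily a) (B.nonMemberSubfamily a) := by
  intro X hX Y hY
  obtain ⟨h1, -⟩ := mem_memberSubfamily.1 hX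
  obtain ⟨h2, h3⟩ := mem_nonMemberSubfamily.1 hY
  have := h _ h1 _ h2
  rwa [insert_inter_of_notMem h3] at this

/-- This is what shifting buys. Since `X ∪ Y` does not fill `S`, the point `a` of `insert a X` can
be traded for some `i` outside both; the traded set still meets `insert a Y`, and it can do so only
inside `X ∩ Y`. -/
theorem CrossIntersecting.member_member (h : CrossIntersecting A B) (ha : ∀ x ∈ S, x < a)
    (hA : A ⊆ powersetCard (l + 1) (insert a S)) (hB : B ⊆ powersetCard (l + 1) (insert a S))
    (hs : IsShiftedOn (insert a S) A) (hl : 2 * l < #S) :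
    CrossIntersecting (A.memberSubfamily a) (B.memberSubfamily a) := by
  have haS : a ∉ S := fun h => lt_irrefl _ (ha a h)
  intro X hX Y hY
  have hX' := mem_powersetCard.1 (memberSubfamily_subset_powersetCard hA hX)
  have hY' := mem_powersetCard.1 (memberSubfamily_subset_powersetCard hB hY)
  obtain ⟨h1, h2⟩ := mem_memberSubfamily.1 hX
  obtain ⟨h3, h4⟩ := mem_memberSubfamily.1 hY
  have hlt : #(X ∪ Y) < #S := (card_union_le X Y).trans_lt (by omega)
  obtain ⟨i, hi, hiXY⟩ := exists_mem_notMem_of_card_lt_card hlt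
  rw [mem_union, not_or] at hiXY
  have hia := ha i hi
  have := hs _ h1 a (mem_insert_self _ _) i (mem_insert_of_mem hi) hia
    (by simp [hia.ne, hiXY.1])
  rw [erase_insert h2] at this
  obtain ⟨z, hz⟩ := h _ this _ h3
  rw [mem_inter, mem_insert, mem_insert] at hz
  rcases hz with ⟨rfl | hz1, hz2⟩
  · exact absurd hz2 (by simp [hia.ne, hiXY.2])
  · rcases hz2 with rfl | hz2
    · exact absurd hz1 h2
    · exact ⟨z, mem_inter.2 ⟨hz1, hz2⟩⟩

/-- A shifted family with many members has many members that avoid the largest element. -/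
theorem IsShiftedOn.le_card_nonMemberSubfamily (ha : ∀ x ∈ S, x < a)
    (hA : A ⊆ powersetCard (l + 1) (insert a S)) (hs : IsShiftedOn (insert a S) A)
    (hm : m ≤ #A) (hml : m + l ≤ #S) : m ≤ #(A.nonMemberSubfamily a) := by
  have haS : a ∉ S := fun h => lt_irrefl _ (ha a h)
  rcases (A.memberSubfamily a).eq_empty_or_nonempty with he | ⟨X, hX⟩
  · have := card_memberSubfamily_add_card_nonMemberSubfamily a A
    rw [he, card_empty] at this
    omega
  · obtain ⟨h1, h2⟩ := mem_memberSubfamily.1 hX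
    have hX' := mem_powersetCard.1 (memberSubfamily_subset_powersetCard hA hX)
    -- A single member through `a` already suffices: trading `a` for each point of `S \ X` gives `#S
    -- - l` distinct members avoiding `a`.
    have hsub : (S \ X).image (fun i => insert i X) ⊆ A.nonMemberSubfamily a := by
      intro Y hY
      obtain ⟨i, hi, rfl⟩ := mem_image.1 hY
      obtain ⟨hiS, hiX⟩ := mem_sdiff.1 hi
      have hia := ha i hiS
      have := hs _ h1 a (mem_insert_self _ _) i (mem_insert_of_mem hiS) hia
        (by simp [hia.ne, hiX])
      rw [erase_insert h2] at this
      exact mem_nonMemberSubfamily.2 ⟨this, by simp [hia.ne', h2]⟩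
    have hinj : Set.InjOn (fun i => insert i X) (S \ X : Finset α) := by
      intro i hi j hj hij
      have : i ∈ insert j X := by
        rw [← show insert i X = insert j X from hij]; exact mem_insert_self _ _
      rcases mem_insert.1 this with h | h
      · exact h
      · exact absurd h (mem_sdiff.1 hi).2
    have := card_le_card hsub
    rw [card_image_of_injOn hinj, card_sdiff_of_subset hX'.1] at this
    omega

theorem CrossIntersecting.empty_notMem (h : CrossIntersecting A B) (hB : B.Nonempty) : ∅ ∉ A := by
  intro hA
  obtain ⟨Y, hY⟩ := hB
  obtain ⟨z, hz⟩ := h ∅ hA Y hY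
  simp at hz

theorem CrossIntersecting.pos_of_subset (h : CrossIntersecting A B) (hAn : A.Nonempty)
    (hB : B.Nonempty) (hA : A ⊆ powersetCard l S) : 0 < l := by
  obtain ⟨X, hX⟩ := hAn
  rw [Nat.pos_iff_ne_zero]
  rintro rfl
  have := card_eq_zero.1 (mem_powersetCard.1 (hA hX)).2
  exact h.empty_notMem hB (this ▸ hX)

/-- Induction on the largest point `a`, starting from `#S = 2 * l`, where complementary pairs give
the bound. The parts avoiding `a` stay nonempty and keep `l`. For the links at `a`, either one is
empty and the other must meet a fixed set, or the induction hypothesis applies with `l` lowered by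
one; Pascal's rule adds the two estimates. -/
theorem CrossIntersecting.card_add_card_le_of_isShiftedOn (hl : 2 * l ≤ #S)
    (hA : A ⊆ powersetCard l S) (hB : B ⊆ powersetCard l S) (h : CrossIntersecting A B)
    (hsA : IsShiftedOn S A) (hsB : IsShiftedOn S B) (hAn : A.Nonempty) (hBn : B.Nonempty) :
    #A + #B + (#S - l).choose l ≤ (#S).choose l + 1 := by
  induction S using Finset.induction_on_max generalizing l A B with
  | empty =>
    have := h.pos_of_subset hAn hBn hA
    simp at hl
    omega
  | insert a S ha ih =>
    obtain ⟨l, rfl⟩ := Nat.exists_eq_succ_of_ne_zero (h.pos_of_subset hAn hBn hA).ne'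
    rw [Nat.succ_eq_add_one] at *
    have haS : a ∉ S := fun h => lt_irrefl _ (ha a h)
    have hcS := card_insert_of_notMem haS
    rcases hl.eq_or_lt with heq | hlt
    · have := h.card_add_card_le hA hB heq.symm
      rw [← heq, show 2 * (l + 1) - (l + 1) = l + 1 by omega, Nat.choose_self]
      omega
    · rw [hcS] at hlt ⊢
      have hA0 := nonMemberSubfamily_subset_powersetCard hA
      have hB0 := nonMemberSubfamily_subset_powersetCard hB
      have hA1 := memberSubfamily_subset_powersetCard hA
      have hB1 := memberSubfamily_subset_powersetCard hB
      have hA0n : (A.nonMemberSubfamily a).Nonempty := card_pos.1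
        (hsA.le_card_nonMemberSubfamily (m := 1) ha hA (card_pos.2 hAn) (by omega))
      have hB0n : (B.nonMemberSubfamily a).Nonempty := card_pos.1
        (hsB.le_card_nonMemberSubfamily (m := 1) ha hB (card_pos.2 hBn) (by omega))
      have h0 := ih (by omega) hA0 hB0
        (h.mono nonMemberSubfamily_subset nonMemberSubfamily_subset)
        (hsA.nonMemberSubfamily haS) (hsB.nonMemberSubfamily haS) hA0n hB0n
      have h1 : #(A.memberSubfamily a) + #(B.memberSubfamily a) + (#S - (l + 1)).choose l ≤
          (#S).choose l := by
        rcases (A.memberSubfamily a).eq_empty_or_nonempty with he | hA1n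
        · obtain ⟨T, hT⟩ := hA0n
          rw [he, card_empty, zero_add, ← (mem_powersetCard.1 (hA0 hT)).2]
          exact card_add_choose_le_of_meets hB1
            fun X hX => h.symm.member_nonMember X hX T hT
        rcases (B.memberSubfamily a).eq_empty_or_nonempty with he | hB1n
        · obtain ⟨T, hT⟩ := hB0n
          rw [he, card_empty, add_zero, ← (mem_powersetCard.1 (hB0 hT)).2]
          exact card_add_choose_le_of_meets hA1
            fun X hX => h.member_nonMember X hX T hT
        have hx := h.member_member ha hA hB hsA (by omega)
        obtain ⟨j, rfl⟩ := Nat.exists_eq_succ_of_ne_zero (hx.pos_of_subset hA1n hB1n hA1).ne'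
        rw [Nat.succ_eq_add_one] at *
        have h2 := ih (by omega) hA1 hB1 hx (hsA.memberSubfamily haS) (hsB.memberSubfamily haS)
          hA1n hB1n
        obtain ⟨d, hd⟩ := Nat.exists_eq_add_of_le (show j + 1 + 1 ≤ #S by omega)
        rw [hd, show j + 1 + 1 + d - (j + 1) = d + 1 by omega, ← hd, Nat.choose_succ_succ'] at h2
        have := Nat.choose_pos (show j ≤ d by omega)
        rw [show #S - (j + 1 + 1) = d by omega]
        omega
      have hcA := card_memberSubfamily_add_card_nonMemberSubfamily a A
      have hcB := card_memberSubfamily_add_card_nonMemberSubfamily a B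
      rw [show #S + 1 - (l + 1) = (#S - (l + 1)) + 1 by omega, Nat.choose_succ_succ,
        Nat.choose_succ_succ]
      rw [Nat.succ_eq_add_one]
      omega

end Shifted

/-! ### Shifted cross-intersecting pairs with two or three members on each side. -/

section Shifted

variable {α : Type*} [LinearOrder α]
variable {S : Finset α} {A B F H T : Finset (Finset α)} {a c : α} {i j l m : ℕ}

theorem CrossIntersecting.card_add_choose_add_choose_le (h : CrossIntersecting H T)
    (hH : H ⊆ powersetCard (i + 1) S) (hT : T ⊆ powersetCard l S) (h2 : 2 ≤ #T) :
    #H + (#S - l).choose (i + 1) + (#S - l - 1).choose i ≤ (#S).choose (i + 1) := by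
  obtain ⟨X, hX, Y, hY, hXY⟩ := one_lt_card.1 h2
  exact card_add_choose_add_choose_le_of_meets hH (hT hX) (hT hY) hXY
    (fun Z hZ => h Z hZ X hX) fun Z hZ => h Z hZ Y hY

theorem CrossIntersecting.card_add_choose_add_choose_lt (h : CrossIntersecting H T)
    (hH : H ⊆ powersetCard (i + 2) S) (hT : T ⊆ powersetCard l S) (h3 : 3 ≤ #T)
    (hS : l + (i + 2) ≤ #S) :
    #H + (#S - l).choose (i + 2) + (#S - l - 1).choose (i + 1) < (#S).choose (i + 2) := by
  obtain ⟨X, hX, Y, hY, Z, hZ, hXY, hXZ, hYZ⟩ := two_lt_card.1 h3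
  exact card_add_choose_add_choose_lt_of_meets hH (hT hX) (hT hY) (hT hZ) hXY hXZ hYZ hS
    (fun W hW => h W hW X hX) (fun W hW => h W hW Y hY) fun W hW => h W hW Z hZ

/-- By Pascal's rule the two sides of the first inequality differ by `(d - 1).choose j - 1`, which
is positive as soon as `1 ≤ j`. With `j = k - 4` in the applications, this is where strictness uses
`k ≥ 5`. -/
theorem choose_add_choose_add_one_le {d j : ℕ} (hd : j + 2 ≤ d) :
    d.choose (j + 2) + (d - 1).choose (j + 1) + 1 ≤ (d + 1).choose (j + 2) ∧
      (1 ≤ j → d.choose (j + 2) + (d - 1).choose (j + 1) + 1 < (d + 1).choose (j + 2)) := by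
  obtain ⟨e, rfl⟩ := Nat.exists_eq_add_of_le' (show 2 ≤ d by omega)
  have h1 : (e + 2 + 1).choose (j + 2) = (e + 2).choose (j + 1) + (e + 2).choose (j + 2) :=
    Nat.choose_succ_succ' (e + 2) (j + 1)
  have h2 : (e + 2).choose (j + 1) = (e + 1).choose j + (e + 1).choose (j + 1) :=
    Nat.choose_succ_succ' (e + 1) j
  have h3 := Nat.choose_pos (show j ≤ e + 1 by omega)
  rw [show e + 2 - 1 = e + 1 by omega]
  refine ⟨by omega, fun hj => ?_⟩
  obtain ⟨p, rfl⟩ := Nat.exists_eq_add_of_le' hj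
  have h4 := Nat.choose_succ_succ' e p
  have h5 := Nat.choose_pos (show p ≤ e by omega)
  have h6 := Nat.choose_pos (show p + 1 ≤ e by omega)
  omega

/-- If one link at `a` is empty, the other must meet two (or three) sets avoiding `a`. If neither is
empty, the bound for nonempty pairs is stronger by `choose_add_choose_add_one_le`. -/
theorem CrossIntersecting.card_memberSubfamily_add_le (ha : ∀ x ∈ S, x < a)
    (hS : 2 * (j + 3) ≤ #S)
    (hA : A ⊆ powersetCard (j + 3) (insert a S)) (hB : B ⊆ powersetCard (j + 3) (insert a S))
    (h : CrossIntersecting A B) (hsA : IsShiftedOn (insert a S) A)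
    (hsB : IsShiftedOn (insert a S) B) (hA2 : 2 ≤ #(A.nonMemberSubfamily a))
    (hB2 : 2 ≤ #(B.nonMemberSubfamily a)) :
    #(A.memberSubfamily a) + #(B.memberSubfamily a) + (#S - (j + 3)).choose (j + 2) +
        (#S - (j + 3) - 1).choose (j + 1) ≤ (#S).choose (j + 2) ∧
      (1 ≤ j → 3 ≤ #(A.nonMemberSubfamily a) → 3 ≤ #(B.nonMemberSubfamily a) →
        #(A.memberSubfamily a) + #(B.memberSubfamily a) + (#S - (j + 3)).choose (j + 2) +
          (#S - (j + 3) - 1).choose (j + 1) < (#S).choose (j + 2)) := by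
  have haS : a ∉ S := fun h => lt_irrefl _ (ha a h)
  have hA0 := nonMemberSubfamily_subset_powersetCard hA
  have hB0 := nonMemberSubfamily_subset_powersetCard hB
  have hA1 := memberSubfamily_subset_powersetCard hA
  have hB1 := memberSubfamily_subset_powersetCard hB
  rcases (A.memberSubfamily a).eq_empty_or_nonempty with he | hA1n
  · rw [he, card_empty, zero_add]
    exact ⟨h.symm.member_nonMember.card_add_choose_add_choose_le hB1 hA0 hA2, fun _ hA3 _ =>
      h.symm.member_nonMember.card_add_choose_add_choose_lt hB1 hA0 hA3 (by omega)⟩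
  rcases (B.memberSubfamily a).eq_empty_or_nonempty with he | hB1n
  · rw [he, card_empty, add_zero]
    exact ⟨h.member_nonMember.card_add_choose_add_choose_le hA1 hB0 hB2, fun _ _ hB3 =>
      h.member_nonMember.card_add_choose_add_choose_lt hA1 hB0 hB3 (by omega)⟩
  have h1 := (h.member_member ha hA hB hsA (by omega)).card_add_card_le_of_isShiftedOn (by omega)
    hA1 hB1 (hsA.memberSubfamily haS) (hsB.memberSubfamily haS) hA1n hB1n
  have h2 := choose_add_choose_add_one_le (d := #S - (j + 3)) (j := j) (by omega)
  rw [show #S - (j + 2) = #S - (j + 3) + 1 by omega] at h1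
  exact ⟨by omega, fun hj _ _ => by have := h2.2 hj; omega⟩

theorem choose_recursion {s k : ℕ} (hs : k + 2 ≤ s) :
    (s + 1).choose (k + 1) = s.choose k + s.choose (k + 1) ∧
    (s + 1 - (k + 1)).choose (k + 1) =
      (s - (k + 1)).choose k + (s - (k + 1)).choose (k + 1) ∧
    (s + 1 - (k + 1) - 1).choose k = (s - (k + 1)).choose k := by
  refine ⟨Nat.choose_succ_succ' _ _, ?_, by rw [show s + 1 - (k + 1) - 1 = s - (k + 1) by omega]⟩
  rw [show s + 1 - (k + 1) = s - (k + 1) + 1 by omega, Nat.choose_succ_succ']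

/-- Strictness is not inherited: the argument for `#S = 2 * (j + 3)` gives only the weak bound. It
is gained in the last step alone, from the links at `a`, so only the weak half of the induction
hypothesis is used. -/
theorem CrossIntersecting.card_add_card_add_le_of_isShiftedOn (hS : 2 * (j + 3) ≤ #S)
    (hA : A ⊆ powersetCard (j + 3) S) (hB : B ⊆ powersetCard (j + 3) S)
    (h : CrossIntersecting A B) (hsA : IsShiftedOn S A) (hsB : IsShiftedOn S B)
    (hA2 : 2 ≤ #A) (hB2 : 2 ≤ #B) :
    #A + #B + (#S - (j + 3)).choose (j + 3) + (#S - (j + 3) - 1).choose (j + 2) ≤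
        (#S).choose (j + 3) + 2 ∧
      (1 ≤ j → 2 * (j + 3) < #S → 3 ≤ #A → 3 ≤ #B →
        #A + #B + (#S - (j + 3)).choose (j + 3) + (#S - (j + 3) - 1).choose (j + 2) <
          (#S).choose (j + 3) + 2) := by
  induction S using Finset.induction_on_max generalizing A B with
  | empty => simp at hS
  | insert a S ha ih =>
    have haS : a ∉ S := fun h => lt_irrefl _ (ha a h)
    have hcS := card_insert_of_notMem haS
    rcases hS.eq_or_lt with heq | hlt
    · have := h.card_add_card_le hA hB heq.symm
      -- Here both subtracted binomials equal 1 and cancel the `+ 2`, leaving the bound by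
      -- complementary pairs.
      rw [← heq, show 2 * (j + 3) - (j + 3) = j + 3 by omega, Nat.choose_self,
        show j + 3 - 1 = j + 2 by omega, Nat.choose_self]
      exact ⟨by omega, by omega⟩
    · rw [hcS] at hlt ⊢
      have hA0 := hsA.le_card_nonMemberSubfamily ha hA hA2 (by omega)
      have hB0 := hsB.le_card_nonMemberSubfamily ha hB hB2 (by omega)
      have h0 := (ih (by omega) (nonMemberSubfamily_subset_powersetCard hA)
        (nonMemberSubfamily_subset_powersetCard hB)
        (h.mono nonMemberSubfamily_subset nonMemberSubfamily_subset)
        (hsA.nonMemberSubfamily haS) (hsB.nonMemberSubfamily haS) hA0 hB0).1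
      have h1 := h.card_memberSubfamily_add_le ha (by omega) hA hB hsA hsB hA0 hB0
      have hcA := card_memberSubfamily_add_card_nonMemberSubfamily a A
      have hcB := card_memberSubfamily_add_card_nonMemberSubfamily a B
      obtain ⟨r1, r2, r3⟩ := choose_recursion (s := #S) (k := j + 2) (by omega)
      have r4 := Nat.choose_succ_succ' (#S - (j + 3) - 1) (j + 1)
      rw [show #S - (j + 3) - 1 + 1 = #S - (j + 3) by omega] at r4
      simp only [Nat.add_assoc, Nat.reduceAdd] at *
      refine ⟨by omega, fun hj _ hA3 hB3 => ?_⟩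
      have := h1.2 hj (hsA.le_card_nonMemberSubfamily ha hA hA3 (by omega))
        (hsB.le_card_nonMemberSubfamily ha hB hB3 (by omega))
      omega

/-! ### Shifted intersecting families, some of whose members avoid the smallest point. -/

theorem nonMemberSubfamily_comm :
    (F.nonMemberSubfamily a).nonMemberSubfamily c =
      (F.nonMemberSubfamily c).nonMemberSubfamily a := by
  ext X
  simp only [mem_nonMemberSubfamily]
  tauto

theorem IsShiftedOn.le_card_nonMemberSubfamily_nonMemberSubfamily (ha : ∀ x ∈ S, x < a)
    (hc : c ∈ S) (hF : F ⊆ powersetCard (l + 1) (insert a S)) (hs : IsShiftedOn (insert a S) F)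
    (hm : m ≤ #(F.nonMemberSubfamily c)) (hml : m + l < #S) :
    m ≤ #((F.nonMemberSubfamily a).nonMemberSubfamily c) := by
  have hac : a ≠ c := (ha c hc).ne'
  rw [nonMemberSubfamily_comm]
  have hs' := hs.nonMemberSubfamily_erase (c := c)
  rw [erase_insert_of_ne hac] at hs'
  refine hs'.le_card_nonMemberSubfamily (l := l) (fun x hx => ha x (mem_of_mem_erase hx)) ?_ hm ?_
  · apply nonMemberSubfamily_subset_powersetCard (l := l + 1)
    rwa [insert_comm, insert_erase hc]
  · rw [card_erase_of_mem hc]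
    omega

/-- A singleton `{x}` with `x ≠ c` would shift to `{c}`, which is disjoint from it. -/
theorem IsShiftedOn.pos_of_nonMemberSubfamily_nonempty (hcS : c ∈ S) (hc : ∀ x ∈ S, c ≤ x)
    (hF : F ⊆ powersetCard (l + 1) S) (hs : IsShiftedOn S F) (h : CrossIntersecting F F)
    (hn : (F.nonMemberSubfamily c).Nonempty) : 0 < l := by
  rw [Nat.pos_iff_ne_zero]
  rintro rfl
  obtain ⟨X, hX⟩ := hn
  obtain ⟨hXF, hcX⟩ := mem_nonMemberSubfamily.1 hX
  obtain ⟨hXS, hX1⟩ := mem_powersetCard.1 (hF hXF)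
  obtain ⟨x, rfl⟩ := card_eq_one.1 hX1
  have hcx : c ≠ x := fun h => hcX (mem_singleton.2 h)
  have := hs _ hXF x (mem_singleton_self x) c hcS
    (lt_of_le_of_ne (hc x (hXS (mem_singleton_self x))) hcx) hcX
  obtain ⟨z, hz⟩ := h _ this _ hXF
  simp only [erase_singleton, mem_inter, mem_insert, mem_singleton, notMem_empty, or_false] at hz
  exact hcx (hz.1.symm.trans hz.2)

theorem card_memberSubfamily_of_nonMemberSubfamily_eq_empty (h : F.nonMemberSubfamily c = ∅) :
    #(F.memberSubfamily c) = #F := by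
  have := card_memberSubfamily_add_card_nonMemberSubfamily c F
  rwa [h, card_empty, add_zero] at this

/-- The Hilton–Milner bound for shifted families. -/
theorem IsShiftedOn.card_add_choose_le (hcS : c ∈ S) (hc : ∀ x ∈ S, c ≤ x)
    (hS : 2 * (l + 1) ≤ #S) (hF : F ⊆ powersetCard (l + 1) S) (hs : IsShiftedOn S F)
    (h : CrossIntersecting F F) (hn : (F.nonMemberSubfamily c).Nonempty) :
    #F + (#S - (l + 2)).choose l ≤ (#S - 1).choose l + 1 := by
  induction S using Finset.induction_on_max generalizing l F with
  | empty => simp at hS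
  | insert a S ha ih =>
    have haS : a ∉ S := fun h => lt_irrefl _ (ha a h)
    have hcard := card_insert_of_notMem haS
    rcases hS.eq_or_lt with heq | hlt
    · have := h.card_self_le hF heq.symm
      rw [← heq, show 2 * (l + 1) - (l + 2) = l by omega, Nat.choose_self,
        show 2 * (l + 1) - 1 = 2 * l + 1 by omega]
      omega
    · obtain ⟨p, rfl⟩ := Nat.exists_eq_succ_of_ne_zero
        (hs.pos_of_nonMemberSubfamily_nonempty hcS hc hF h hn).ne'
      rw [Nat.succ_eq_add_one] at *
      rw [hcard] at hlt ⊢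
      have hcS' : c ∈ S := by
        rcases mem_insert.1 hcS with rfl | h
        · obtain ⟨x, hx⟩ := card_pos.1 (show 0 < #S by omega)
          exact absurd (hc x (mem_insert_of_mem hx)) (ha x hx).not_ge
        · exact h
      have hc' : ∀ x ∈ S, c ≤ x := fun x hx => hc x (mem_insert_of_mem hx)
      have hF0 := nonMemberSubfamily_subset_powersetCard hF
      have hF1 := memberSubfamily_subset_powersetCard hF
      have hF0n : ((F.nonMemberSubfamily a).nonMemberSubfamily c).Nonempty := card_pos.1
        (hs.le_card_nonMemberSubfamily_nonMemberSubfamily (m := 1) ha hcS' hF (card_pos.2 hn)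
          (by omega))
      have h0 := ih hcS' hc' (by omega) hF0 (hs.nonMemberSubfamily haS)
        (h.mono nonMemberSubfamily_subset nonMemberSubfamily_subset) hF0n
      -- Either all links at `a` contain `c` and, with `c` removed, must meet a member `T` that
      -- avoids both `a` and `c`; or the links satisfy the induction hypothesis, whose `+ 1` is
      -- absorbed by a binomial from Pascal's rule.
      have h1 : #(F.memberSubfamily a) + (#S - (p + 3)).choose p ≤ (#S - 1).choose p := by
        rcases ((F.memberSubfamily a).nonMemberSubfamily c).eq_empty_or_nonempty with he | hF1n
        · obtain ⟨T, hT⟩ := hF0n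
          have hTc := (mem_nonMemberSubfamily.1 hT).2
          obtain ⟨hTS, hTcard⟩ := mem_powersetCard.1 (hF0 (nonMemberSubfamily_subset hT))
          rw [← card_memberSubfamily_of_nonMemberSubfamily_eq_empty he]
          have hH : (F.memberSubfamily a).memberSubfamily c ⊆ powersetCard p (S.erase c) :=
            memberSubfamily_subset_powersetCard (by rwa [insert_erase hcS'])
          have := card_add_choose_le_of_meets hH
            fun X hX => h.member_nonMember.member_nonMember X hX T hT
          rwa [card_erase_of_mem hcS', hTcard, show #S - 1 - (p + 1 + 1) = #S - (p + 3) by omega]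
            at this
        · have hx := h.member_member ha hF hF hs (by omega)
          obtain ⟨j, rfl⟩ := Nat.exists_eq_succ_of_ne_zero
            ((hs.memberSubfamily haS).pos_of_nonMemberSubfamily_nonempty hcS' hc' hF1 hx hF1n).ne'
          rw [Nat.succ_eq_add_one] at *
          have h2 := ih hcS' hc' (by omega) hF1 (hs.memberSubfamily haS) hx hF1n
          rw [show #S - (j + 1 + 2) = #S - (j + 1 + 3) + 1 by omega, Nat.choose_succ_succ'] at h2
          have := Nat.choose_pos (show j ≤ #S - (j + 1 + 3) by omega)
          omega
      have hcF := card_memberSubfamily_add_card_nonMemberSubfamily a F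
      have r1 := Nat.choose_succ_succ' (#S - 1) p
      have r2 := Nat.choose_succ_succ' (#S - (p + 3)) p
      rw [show #S - 1 + 1 = #S by omega] at r1
      rw [Nat.add_sub_cancel, show #S + 1 - (p + 1 + 2) = #S - (p + 3) + 1 by omega]
      rw [show p + 1 + 2 = p + 3 by omega] at h0
      omega

theorem IsShiftedOn.card_memberSubfamily_add_le (ha : ∀ x ∈ S, x < a) (hcS : c ∈ S)
    (hc : ∀ x ∈ S, c ≤ x) (hS : 2 * (j + 4) ≤ #S) (hF : F ⊆ powersetCard (j + 4) (insert a S))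
    (hs : IsShiftedOn (insert a S) F) (h : CrossIntersecting F F)
    (h3 : 3 ≤ #((F.nonMemberSubfamily a).nonMemberSubfamily c)) :
    #(F.memberSubfamily a) + (#S - (j + 5)).choose (j + 2) + (#S - (j + 5) - 1).choose (j + 1) ≤
        (#S - 1).choose (j + 2) ∧
      (1 ≤ j → #(F.memberSubfamily a) + (#S - (j + 5)).choose (j + 2) +
        (#S - (j + 5) - 1).choose (j + 1) < (#S - 1).choose (j + 2)) := by
  have haS : a ∉ S := fun h => lt_irrefl _ (ha a h)
  have hF0 := nonMemberSubfamily_subset_powersetCard hF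
  have hF1 := memberSubfamily_subset_powersetCard hF
  rcases ((F.memberSubfamily a).nonMemberSubfamily c).eq_empty_or_nonempty with he | hF1n
  · rw [← card_memberSubfamily_of_nonMemberSubfamily_eq_empty he]
    have hcard : #(S.erase c) = #S - 1 := card_erase_of_mem hcS
    have hH : (F.memberSubfamily a).memberSubfamily c ⊆ powersetCard (j + 2) (S.erase c) :=
      memberSubfamily_subset_powersetCard (by rwa [insert_erase hcS])
    have hT : (F.nonMemberSubfamily a).nonMemberSubfamily c ⊆ powersetCard (j + 4) (S.erase c) :=
      nonMemberSubfamily_subset_powersetCard (by rwa [insert_erase hcS])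
    have := (h.member_nonMember (a := a)).member_nonMember.card_add_choose_add_choose_lt hH hT h3
      (by omega)
    rw [hcard, show #S - 1 - (j + 4) = #S - (j + 5) by omega] at this
    exact ⟨this.le, fun _ => this⟩
  · have h1 := (hs.memberSubfamily haS).card_add_choose_le hcS hc (by omega) hF1
      (h.member_member ha hF hF hs (by omega)) hF1n
    have h2 := choose_add_choose_add_one_le (d := #S - (j + 5)) (j := j) (by omega)
    rw [show #S - (j + 2 + 2) = #S - (j + 5) + 1 by omega] at h1
    exact ⟨by omega, fun hj => by have := h2.2 hj; omega⟩

/-- The same induction with three members avoiding `c`. The links at `a` either all contain `c` and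
must meet three sets, or obey the Hilton–Milner bound. Strictness again comes from the last step
only. -/
theorem IsShiftedOn.card_add_choose_add_choose_le (hcS : c ∈ S) (hc : ∀ x ∈ S, c ≤ x)
    (hS : 2 * (j + 4) ≤ #S) (hF : F ⊆ powersetCard (j + 4) S) (hs : IsShiftedOn S F)
    (h : CrossIntersecting F F) (h3 : 3 ≤ #(F.nonMemberSubfamily c)) :
    #F + (#S - (j + 5)).choose (j + 3) + (#S - (j + 5) - 1).choose (j + 2) ≤
        (#S - 1).choose (j + 3) + 2 ∧
      (1 ≤ j → 2 * (j + 4) < #S → #F + (#S - (j + 5)).choose (j + 3) +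
        (#S - (j + 5) - 1).choose (j + 2) < (#S - 1).choose (j + 3) + 2) := by
  induction S using Finset.induction_on_max generalizing F with
  | empty => simp at hS
  | insert a S ha ih =>
    have haS : a ∉ S := fun h => lt_irrefl _ (ha a h)
    have hcard := card_insert_of_notMem haS
    rcases hS.eq_or_lt with heq | hlt
    · have := h.card_self_le hF heq.symm
      rw [← heq, show 2 * (j + 4) - (j + 5) = j + 3 by omega, Nat.choose_self,
        show j + 3 - 1 = j + 2 by omega, Nat.choose_self,
        show 2 * (j + 4) - 1 = 2 * (j + 3) + 1 by omega]
      exact ⟨by omega, by omega⟩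
    · rw [hcard] at hlt ⊢
      have hcS' : c ∈ S := by
        rcases mem_insert.1 hcS with rfl | h
        · obtain ⟨x, hx⟩ := card_pos.1 (show 0 < #S by omega)
          exact absurd (hc x (mem_insert_of_mem hx)) (ha x hx).not_ge
        · exact h
      have hc' : ∀ x ∈ S, c ≤ x := fun x hx => hc x (mem_insert_of_mem hx)
      have hF0 := hs.le_card_nonMemberSubfamily_nonMemberSubfamily ha hcS' hF h3 (by omega)
      have h0 := (ih hcS' hc' (by omega) (nonMemberSubfamily_subset_powersetCard hF)
        (hs.nonMemberSubfamily haS) (h.mono nonMemberSubfamily_subset nonMemberSubfamily_subset)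
        hF0).1
      have h1 := hs.card_memberSubfamily_add_le ha hcS' hc' (by omega) hF h hF0
      have hcF := card_memberSubfamily_add_card_nonMemberSubfamily a F
      have r1 := Nat.choose_succ_succ' (#S - 1) (j + 2)
      have r2 := Nat.choose_succ_succ' (#S - (j + 5)) (j + 2)
      have r3 := Nat.choose_succ_succ' (#S - (j + 5) - 1) (j + 1)
      rw [show #S - 1 + 1 = #S by omega] at r1
      rw [show #S - (j + 5) - 1 + 1 = #S - (j + 5) by omega] at r3
      rw [show #S + 1 - (j + 5) = #S - (j + 5) + 1 by omega, Nat.add_sub_cancel,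
        Nat.add_sub_cancel]
      simp only [Nat.add_assoc, Nat.reduceAdd] at *
      refine ⟨by omega, fun hj _ => ?_⟩
      have := h1.2 hj
      omega

end Shifted

/-! ### Shifts as `UV`-compressions by singletons. -/

section Compression

open UV

variable {α : Type*} [DecidableEq α] {F A B : Finset (Finset α)} {X S : Finset α} {i j c : α}
  {l : ℕ}

theorem compress_singleton_of_mem (hi : i ∉ X) (hj : j ∈ X) :
    compress {i} {j} X = insert i (X.erase j) := by
  have hij : i ≠ j := fun h => hi (h ▸ hj)
  rw [compress_of_disjoint_of_le (disjoint_singleton_left.2 hi) (singleton_subset_iff.2 hj)]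
  ext x
  simp only [sup_eq_union, mem_sdiff, mem_union, mem_singleton, mem_insert, mem_erase]
  grind

theorem compress_singleton_of_not (h : ¬ (i ∉ X ∧ j ∈ X)) : compress {i} {j} X = X := by
  unfold compress
  rw [if_neg]
  rintro ⟨h1, h2⟩
  exact h ⟨disjoint_singleton_left.1 h1, singleton_subset_iff.1 h2⟩

theorem mem_compression_singleton : X ∈ compression {i} {j} F ↔
    (X ∈ F ∧ (i ∉ X → j ∈ X → insert i (X.erase j) ∈ F)) ∨
      (X ∉ F ∧ ∃ Y ∈ F, i ∉ Y ∧ j ∈ Y ∧ insert i (Y.erase j) = X) := by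
  rw [mem_compression]
  refine or_congr (and_congr_right fun hX => ?_) (and_congr_right fun hX => ?_)
  · by_cases h : i ∉ X ∧ j ∈ X
    · rw [compress_singleton_of_mem h.1 h.2]
      tauto
    · rw [compress_singleton_of_not h]
      tauto
  · refine exists_congr fun Y => and_congr_right fun hY => ?_
    by_cases h : i ∉ Y ∧ j ∈ Y
    · rw [compress_singleton_of_mem h.1 h.2]
      tauto
    · rw [compress_singleton_of_not h]
      constructor
      · rintro rfl
        exact absurd hY hX
      · exact fun h' => absurd ⟨h'.1, h'.2.1⟩ h

theorem compression_singleton_subset_powersetCard (hi : i ∈ S) (hF : F ⊆ powersetCard l S) :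
    compression {i} {j} F ⊆ powersetCard l S := by
  intro X hX
  rcases mem_compression_singleton.1 hX with ⟨h, -⟩ | ⟨-, Y, hY, hiY, hjY, rfl⟩
  · exact hF h
  · obtain ⟨h1, h2⟩ := mem_powersetCard.1 (hF hY)
    refine mem_powersetCard.2 ⟨insert_subset hi ((erase_subset _ _).trans h1), ?_⟩
    rw [card_insert_of_notMem (by simp [hiY]), card_erase_of_mem hjY, h2]
    have := card_pos.2 ⟨j, hjY⟩
    omega

/-- The case of a moved `X` against an unmoved `Y`. If `Y` contains `j` but not `i`, it stayed
because its shift is already in `B`; a common point of that shift and the original `X` is neither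
`i` nor `j`, so it survives. -/
theorem CrossIntersecting.exists_mem_inter_of_compression (h : CrossIntersecting A B)
    {X Y : Finset α} (hX : X ∈ A) (hiX : i ∉ X)
    (hY : Y ∈ B ∧ (i ∉ Y → j ∈ Y → insert i (Y.erase j) ∈ B)) :
    (insert i (X.erase j) ∩ Y).Nonempty := by
  by_cases hiY : i ∈ Y
  · exact ⟨i, by simp [hiY]⟩
  by_cases hjY : j ∈ Y
  · obtain ⟨z, hz⟩ := h X hX _ (hY.2 hiY hjY)
    refine ⟨z, ?_⟩
    simp only [mem_inter, mem_insert, mem_erase] at hz ⊢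
    grind
  · obtain ⟨z, hz⟩ := h X hX Y hY.1
    refine ⟨z, ?_⟩
    simp only [mem_inter, mem_insert, mem_erase] at hz ⊢
    grind

theorem CrossIntersecting.compression_singleton (h : CrossIntersecting A B) (i j : α) :
    CrossIntersecting (compression {i} {j} A) (compression {i} {j} B) := by
  intro X hX Y hY
  rcases mem_compression_singleton.1 hX with hX' | ⟨-, X₀, hX₀, hiX, hjX, rfl⟩ <;>
  rcases mem_compression_singleton.1 hY with hY' | ⟨-, Y₀, hY₀, hiY, hjY, rfl⟩
  · exact h X hX'.1 Y hY'.1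
  · rw [inter_comm]
    exact h.symm.exists_mem_inter_of_compression hY₀ hiY hX'
  · exact h.exists_mem_inter_of_compression hX₀ hiX hY'
  · exact ⟨i, by simp⟩

/-- A shift inserts only `i`, so `i` is the only point that fewer members can avoid afterwards. -/
theorem card_nonMemberSubfamily_le_compression (hc : c ≠ i) :
    #(F.nonMemberSubfamily c) ≤ #((compression {i} {j} F).nonMemberSubfamily c) := by
  rw [← card_compression {i} {j} (F.nonMemberSubfamily c)]
  refine card_le_card fun X hX => ?_
  rw [mem_nonMemberSubfamily, mem_compression_singleton]
  rcases mem_compression_singleton.1 hX with ⟨h1, h2⟩ | ⟨h1, Y, hY, hiY, hjY, rfl⟩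
  · simp only [mem_nonMemberSubfamily] at h1 h2
    exact ⟨Or.inl ⟨h1.1, fun ha hb => (h2 ha hb).1⟩, h1.2⟩
  · simp only [mem_nonMemberSubfamily] at h1 hY
    have hcX : c ∉ insert i (Y.erase j) := by simp [hc, hY.2]
    exact ⟨Or.inr ⟨fun h => h1 ⟨h, hcX⟩, Y, hY.1, hiY, hjY, rfl⟩, hcX⟩

/-- Sets avoiding both points do not move. Hence if few members of the shifted family avoid `i`, few
members of `F` avoid both `i` and `j`. -/
theorem nonMemberSubfamily_nonMemberSubfamily_subset_compression :
    (F.nonMemberSubfamily i).nonMemberSubfamily j ⊆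
      (compression {i} {j} F).nonMemberSubfamily i := by
  intro X hX
  simp only [mem_nonMemberSubfamily] at hX
  rw [mem_nonMemberSubfamily, mem_compression_singleton]
  exact ⟨Or.inl ⟨hX.1.1, fun _ h => absurd h hX.2⟩, hX.1.2⟩

end Compression

/-! ### Termination of shifting, and the bounds for families that need not be shifted. -/

section Measure

open UV

variable {n : ℕ} {S : Finset (Fin n)} {F A B : Finset (Finset (Fin n))} {i j : Fin n} {l : ℕ}

/-- The sum of all elements of all members of `F`. -/
def elementSum (F : Finset (Finset (Fin n))) : ℕ := ∑ X ∈ F, ∑ x ∈ X, (x : ℕ)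

theorem elementSum_compression_lt (hij : i < j) (h : compression {i} {j} F ≠ F) :
    elementSum (compression {i} {j} F) < elementSum F := by
  have hlt : ∀ X ∈ F.filter (fun X => compress {i} {j} X ∉ F),
      ∑ x ∈ compress {i} {j} X, (x : ℕ) < ∑ x ∈ X, (x : ℕ) := by
    intro X hX
    obtain ⟨h1, h2⟩ := mem_filter.1 hX
    have hX' : i ∉ X ∧ j ∈ X := by
      by_contra hcon
      rw [compress_singleton_of_not hcon] at h2
      exact h2 h1
    rw [compress_singleton_of_mem hX'.1 hX'.2, sum_insert (by simp [hX'.1]),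
      ← add_sum_erase X _ hX'.2]
    exact Nat.add_lt_add_right hij _
  have hne : (F.filter (fun X => compress {i} {j} X ∉ F)).Nonempty := by
    rw [nonempty_iff_ne_empty]
    intro he
    apply h
    have hkeep : F.filter (fun X => compress {i} {j} X ∈ F) = F := by
      refine filter_true_of_mem fun X hX => ?_
      by_contra hcon
      have : X ∈ F.filter (fun X => compress {i} {j} X ∉ F) := mem_filter.2 ⟨hX, hcon⟩
      rw [he] at this
      exact notMem_empty _ this
    rw [compression, filter_image, he, image_empty, union_empty, hkeep]
  have hF := sum_filter_add_sum_filter_not F (fun X => compress {i} {j} X ∈ F)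
    (fun X => ∑ x ∈ X, (x : ℕ))
  rw [elementSum, elementSum, compression, sum_union compress_disjoint, filter_image,
    sum_image compress_injOn, ← hF]
  exact Nat.add_lt_add_left (sum_lt_sum_of_nonempty hne hlt) _

theorem elementSum_compression_le (hij : i < j) :
    elementSum (compression {i} {j} F) ≤ elementSum F := by
  by_cases h : compression {i} {j} F = F
  · rw [h]
  · exact (elementSum_compression_lt hij h).le

theorem isShiftedOn_of_compression_eq
    (h : ∀ i ∈ S, ∀ j, i < j → compression {i} {j} F = F) : IsShiftedOn S F := by
  intro X hX j hj i hi hij hiX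
  rw [← h i hi j hij] at hX
  rcases mem_compression_singleton.1 hX with ⟨-, h2⟩ | ⟨h1, -⟩
  · exact h2 hiX hj
  · exact absurd (h i hi j hij ▸ hX) h1

/-- Both families are compressed by the same pair at each step, which keeps them cross-intersecting;
the total `elementSum` decreases until neither changes. -/
theorem CrossIntersecting.exists_isShiftedOn (h : CrossIntersecting A B)
    (hA : A ⊆ powersetCard l S) (hB : B ⊆ powersetCard l S) :
    ∃ A' B', A' ⊆ powersetCard l S ∧ B' ⊆ powersetCard l S ∧ CrossIntersecting A' B' ∧
      IsShiftedOn S A' ∧ IsShiftedOn S B' ∧ #A' = #A ∧ #B' = #B := by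
  induction hw : elementSum A + elementSum B using Nat.strong_induction_on generalizing A B with
  | _ w ih =>
    by_cases hs : ∃ i ∈ S, ∃ j, i < j ∧
        (compression {i} {j} A ≠ A ∨ compression {i} {j} B ≠ B)
    · obtain ⟨i, hi, j, hij, hne⟩ := hs
      have hlt : elementSum (compression {i} {j} A) + elementSum (compression {i} {j} B) < w := by
        have h1 := elementSum_compression_le (F := A) hij
        have h2 := elementSum_compression_le (F := B) hij
        rcases hne with hne | hne
        · have := elementSum_compression_lt hij hne
          omega
        · have := elementSum_compression_lt hij hne
          omega
      obtain ⟨A', B', h1, h2, h3, h4, h5, h6, h7⟩ := ih _ hlt (h.compression_singleton i j)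
        (compression_singleton_subset_powersetCard hi hA)
        (compression_singleton_subset_powersetCard hi hB) rfl
      rw [card_compression] at h6 h7
      exact ⟨A', B', h1, h2, h3, h4, h5, h6, h7⟩
    · push Not at hs
      exact ⟨A, B, hA, hB, h, isShiftedOn_of_compression_eq fun i hi j hij => (hs i hi j hij).1,
        isShiftedOn_of_compression_eq fun i hi j hij => (hs i hi j hij).2, rfl, rfl⟩

theorem CrossIntersecting.card_add_card_le_of_nonempty (hl : 2 * l ≤ #S)
    (hA : A ⊆ powersetCard l S) (hB : B ⊆ powersetCard l S) (h : CrossIntersecting A B)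
    (hAn : A.Nonempty) (hBn : B.Nonempty) :
    #A + #B + (#S - l).choose l ≤ (#S).choose l + 1 := by
  obtain ⟨A', B', h1, h2, h3, h4, h5, h6, h7⟩ := h.exists_isShiftedOn hA hB
  rw [← card_pos] at hAn hBn
  rw [← h6, ← h7]
  exact h3.card_add_card_le_of_isShiftedOn hl h1 h2 h4 h5 (card_pos.1 (by omega))
    (card_pos.1 (by omega))

theorem CrossIntersecting.card_add_card_add_le_of_two_le {p : ℕ} (hS : 2 * (p + 3) < #S)
    (hA : A ⊆ powersetCard (p + 3) S) (hB : B ⊆ powersetCard (p + 3) S)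
    (h : CrossIntersecting A B) (hA2 : 2 ≤ #A) (hB2 : 2 ≤ #B) :
    #A + #B + (#S - (p + 3)).choose (p + 3) + (#S - (p + 3) - 1).choose (p + 2) ≤
        (#S).choose (p + 3) + 2 ∧
      (1 ≤ p → 3 ≤ #A → 3 ≤ #B →
        #A + #B + (#S - (p + 3)).choose (p + 3) + (#S - (p + 3) - 1).choose (p + 2) <
          (#S).choose (p + 3) + 2) := by
  obtain ⟨A', B', h1, h2, h3, h4, h5, h6, h7⟩ := h.exists_isShiftedOn hA hB
  rw [← h6] at hA2 ⊢
  rw [← h7] at hB2 ⊢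
  have := h3.card_add_card_add_le_of_isShiftedOn hS.le h1 h2 h4 h5 hA2 hB2
  exact ⟨this.1, fun hp => this.2 hp hS⟩

theorem two_le_choose {d p : ℕ} (hp : 1 ≤ p) (hd : p < d) : 2 ≤ d.choose p := by
  obtain ⟨q, rfl⟩ := Nat.exists_eq_add_of_le' hp
  obtain ⟨e, rfl⟩ := Nat.exists_eq_add_of_le' (show 1 ≤ d by omega)
  have h1 := Nat.choose_succ_succ' e q
  have h2 := Nat.choose_pos (show q ≤ e by omega)
  have h3 := Nat.choose_pos (show q + 1 ≤ e by omega)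
  omega

/-- Families most of whose members meet a fixed pair `{x, y}`. -/
theorem card_add_choose_add_choose_le_of_pair {x y : Fin n} {p : ℕ} (hxy : x ≠ y)
    (hn : 2 * (p + 4) < n) (hF : F ⊆ powersetCard (p + 4) univ) (h : CrossIntersecting F F)
    (h3 : ∀ c, 3 ≤ #(F.nonMemberSubfamily c))
    (hG : #((F.nonMemberSubfamily x).nonMemberSubfamily y) ≤ 2) :
    #F + (n - (p + 5)).choose (p + 3) + (n - (p + 5) - 1).choose (p + 2) ≤
        (n - 1).choose (p + 3) + 2 ∧
      (1 ≤ p → #F + (n - (p + 5)).choose (p + 3) + (n - (p + 5) - 1).choose (p + 2) <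
        (n - 1).choose (p + 3) + 2) := by
  obtain ⟨s, rfl⟩ := Nat.exists_eq_add_of_le' (show 2 ≤ n by omega)
  set S := (univ.erase x).erase y with hS
  have hyx : y ∈ univ.erase x := mem_erase.2 ⟨hxy.symm, mem_univ y⟩
  have hcS : #S = s := by
    rw [hS, card_erase_of_mem hyx, card_erase_of_mem (mem_univ x), card_univ, Fintype.card_fin]
    rfl
  have hi1 : insert y S = univ.erase x := insert_erase hyx
  have hi2 : insert x (univ.erase x) = (univ : Finset (Fin (s + 2))) := insert_erase (mem_univ x)
  set A := (F.memberSubfamily x).nonMemberSubfamily y with hAdef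
  set B := (F.nonMemberSubfamily x).memberSubfamily y with hBdef
  set D := (F.memberSubfamily x).memberSubfamily y with hDdef
  set G := (F.nonMemberSubfamily x).nonMemberSubfamily y with hGdef
  have hFx : F.memberSubfamily x ⊆ powersetCard (p + 3) (insert y S) := by
    rw [hi1]; exact memberSubfamily_subset_powersetCard (by rwa [hi2])
  have hFx' : F.nonMemberSubfamily x ⊆ powersetCard (p + 4) (insert y S) := by
    rw [hi1]; exact nonMemberSubfamily_subset_powersetCard (by rwa [hi2])
  have hA : A ⊆ powersetCard (p + 3) S := nonMemberSubfamily_subset_powersetCard hFx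
  have hB : B ⊆ powersetCard (p + 3) S := memberSubfamily_subset_powersetCard hFx'
  have hD : D ⊆ powersetCard (p + 2) S := memberSubfamily_subset_powersetCard hFx
  have hGS : G ⊆ powersetCard (p + 4) S := nonMemberSubfamily_subset_powersetCard hFx'
  have hAB : CrossIntersecting A B := (h.member_nonMember.symm.member_nonMember).symm
  have hDG : CrossIntersecting D G := h.member_nonMember.member_nonMember
  have c1 := card_memberSubfamily_add_card_nonMemberSubfamily x F
  have c2 := card_memberSubfamily_add_card_nonMemberSubfamily y (F.memberSubfamily x)
  have c3 := card_memberSubfamily_add_card_nonMemberSubfamily y (F.nonMemberSubfamily x)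
  have c4 := card_memberSubfamily_add_card_nonMemberSubfamily x (F.nonMemberSubfamily y)
  have c5 : #((F.nonMemberSubfamily y).memberSubfamily x) = #A := by
    congr 1
    ext X
    simp only [hAdef, mem_nonMemberSubfamily, mem_memberSubfamily, mem_insert]
    grind
  rw [nonMemberSubfamily_comm, c5] at c4
  rw [← hAdef, ← hDdef] at c2
  rw [← hBdef, ← hGdef] at c3
  rw [← hGdef] at c4
  have h3x := h3 x
  have h3y := h3 y
  have r1 := Nat.choose_succ_succ' s (p + 2)
  rw [show s + 2 - (p + 5) = s - (p + 3) by omega, show s + 2 - 1 = s + 1 by omega]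
  have hDle := card_le_card hD
  rw [card_powersetCard, hcS] at hDle
  simp only [Nat.add_assoc, Nat.reduceAdd] at r1
  -- Every point is avoided by three members, so `A` and `B` each have at least `3 - #G` members. As
  -- `#G` grows, the bound on `#A + #B` weakens while `D`, whose members must meet those of `G`,
  -- shrinks by more.
  rcases Nat.lt_or_ge #G 1 with hG0 | hG1
  · have := hAB.card_add_card_add_le_of_two_le (by omega) hA hB (by omega) (by omega)
    rw [hcS] at this
    exact ⟨by omega, fun hp => by have := this.2 hp (by omega) (by omega); omega⟩
  rcases Nat.lt_or_ge #G 2 with hG1' | hG2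
  · have := hAB.card_add_card_add_le_of_two_le (by omega) hA hB (by omega) (by omega)
    rw [hcS] at this
    obtain ⟨T, hT⟩ := card_pos.1 (show 0 < #G by omega)
    have hD1 := card_add_choose_le_of_meets hD fun X hX => hDG X hX T hT
    rw [(mem_powersetCard.1 (hGS hT)).2, hcS] at hD1
    have h2 := two_le_choose (show 1 ≤ p + 2 by omega) (show p + 2 < s - (p + 4) by omega)
    exact ⟨by omega, by omega⟩
  · have := hAB.card_add_card_le_of_nonempty (by omega) hA hB (card_pos.1 (by omega))
      (card_pos.1 (by omega))
    rw [hcS] at this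
    have hD1 : #D + (#S - (p + 4)).choose (p + 2) + (#S - (p + 4) - 1).choose (p + 1) ≤
        (#S).choose (p + 2) := hDG.card_add_choose_add_choose_le hD hGS hG2
    rw [hcS] at hD1
    have h2 := two_le_choose (show 1 ≤ p + 1 by omega) (show p + 1 < s - (p + 4) - 1 by omega)
    -- The binomial lacking in the bound for nonempty pairs is exactly the first loss of `D`; the
    -- second loss, at least 2, outweighs the surplus 1 left by the bounds once `#G = 2` is added.
    rw [show s - (p + 3) - 1 = s - (p + 4) by omega]
    exact ⟨by omega, by omega⟩

theorem CrossIntersecting.card_add_choose_add_choose_le_of_three_le {p : ℕ}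
    (hn : 2 * (p + 4) < n) (hF : F ⊆ powersetCard (p + 4) univ) (h : CrossIntersecting F F)
    (h3 : ∀ c, 3 ≤ #(F.nonMemberSubfamily c)) :
    #F + (n - (p + 5)).choose (p + 3) + (n - (p + 5) - 1).choose (p + 2) ≤
        (n - 1).choose (p + 3) + 2 ∧
      (1 ≤ p → #F + (n - (p + 5)).choose (p + 3) + (n - (p + 5) - 1).choose (p + 2) <
        (n - 1).choose (p + 3) + 2) := by
  induction hw : elementSum F using Nat.strong_induction_on generalizing F with
  | _ w ih =>
    by_cases hs : ∃ i j : Fin n, i < j ∧ compression {i} {j} F ≠ F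
    · obtain ⟨i, j, hij, hne⟩ := hs
      by_cases hd : ∀ c, 3 ≤ #((compression {i} {j} F).nonMemberSubfamily c)
      · have := ih _ (hw ▸ elementSum_compression_lt hij hne)
          (compression_singleton_subset_powersetCard (mem_univ i) hF)
          (h.compression_singleton i j) hd rfl
        rwa [card_compression] at this
      · push Not at hd
        obtain ⟨c, hc⟩ := hd
        -- Only `i` can have lost avoiding members, so at most two members of `F` avoid both `i` and
        -- `j`, and the bound for a pair applies to `F` itself.
        have hci : c = i := by
          by_contra hci
          exact absurd (h3 c) (by
            have := card_nonMemberSubfamily_le_compression (F := F) (j := j) hci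
            omega)
        subst hci
        have := card_le_card (nonMemberSubfamily_nonMemberSubfamily_subset_compression
          (F := F) (i := c) (j := j))
        exact card_add_choose_add_choose_le_of_pair hij.ne hn hF h h3 (by omega)
    · push Not at hs
      have hsF : IsShiftedOn univ F :=
        isShiftedOn_of_compression_eq fun i _ j hij => hs i j hij
      have hcard : #(univ : Finset (Fin n)) = n := by simp
      have := hsF.card_add_choose_add_choose_le (c := ⟨0, by omega⟩) (mem_univ _)
        (fun x _ => Nat.zero_le _) (by omega) hF h (h3 _)
      rw [hcard] at this
      exact ⟨this.1, fun hp => this.2 hp hn⟩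

end Measure

/-! ### When the count for two sets is attained. -/

section Extremal

variable {α : Type*} [DecidableEq α] {S T₁ T₂ : Finset α} {H : Finset (Finset α)} {i l : ℕ}

/-- With two points `x`, `y` in `T₁ \ T₂`, take `t = x` in the count. A set through `y` that avoids
`x` and `T₂` is then not among the excluded sets, yet it is not in `H`. -/
theorem card_add_choose_add_choose_lt_of_card_sdiff (hH : H ⊆ powersetCard (i + 1) S)
    (hT₁ : T₁ ∈ powersetCard l S) (hT₂ : T₂ ∈ powersetCard l S) (hd : 2 ≤ #(T₁ \ T₂))
    (hS : l + (i + 2) ≤ #S) (h₁ : ∀ X ∈ H, (X ∩ T₁).Nonempty) (h₂ : ∀ X ∈ H, (X ∩ T₂).Nonempty) :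
    #H + (#S - l).choose (i + 1) + (#S - l - 1).choose i < (#S).choose (i + 1) := by
  obtain ⟨x, hx, y, hy, hxy⟩ := one_lt_card.1 hd
  rw [mem_sdiff] at hx hy
  rw [mem_powersetCard] at hT₁ hT₂
  have hyU : ({y} : Finset α) ⊆ (S \ T₂).erase x := by
    simp [hxy.symm, hT₁.1 hy.1, hy.2]
  have hcard : i + 1 ≤ #((S \ T₂).erase x) := by
    have h1 := le_card_sdiff T₂ S
    have h2 := pred_card_le_card_erase (s := S \ T₂) (a := x)
    omega
  obtain ⟨Z, hZ1, hZ2, hZ3⟩ := exists_subsuperset_card_eq hyU (by simp) hcard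
  have hyZ : y ∈ Z := hZ1 (mem_singleton_self y)
  have hZS : Z ⊆ S \ T₂ := hZ2.trans (erase_subset _ _)
  have hxZ : x ∉ Z := fun h => notMem_erase x _ (hZ2 h)
  have hZH : Z ∉ H := by
    intro hZ
    obtain ⟨z, hz⟩ := h₂ Z hZ
    exact (mem_sdiff.1 (hZS (mem_inter.1 hz).1)).2 (mem_inter.1 hz).2
  -- `Z` misses `T₂`, which is allowed because the condition on `T₂` concerns only sets containing
  -- `x`.
  have := card_add_choose_add_choose_le_of_mem (H := insert Z H)
    (insert_subset (mem_powersetCard.2 ⟨hZS.trans sdiff_subset, hZ3⟩) hH) (hT₁.1 hx.1) hx.1 hx.2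
    (forall_mem_insert _ _ _ |>.2 ⟨⟨⟨y, mem_inter.2 ⟨hyZ, hy.1⟩⟩, fun h => absurd h hxZ⟩,
      fun X hX => ⟨h₁ X hX, fun _ => h₂ X hX⟩⟩)
  rw [card_insert_of_notMem hZH, hT₁.2, hT₂.2] at this
  omega

/-- If `t` is the only point of `T₁ \ T₂`, a set that meets `T₁` but misses `T₂` must contain `t`.
So the two excluded classes account for every set outside the filter. -/
theorem choose_le_card_filter_meets (hT₁ : T₁ ∈ powersetCard l S) (hT₂ : T₂ ∈ powersetCard l S)
    (hd : #(T₁ \ T₂) = 1) :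
    (#S).choose (i + 1) ≤ #((powersetCard (i + 1) S).filter
      (fun X => (X ∩ T₁).Nonempty ∧ (X ∩ T₂).Nonempty)) +
        (#S - l).choose (i + 1) + (#S - l - 1).choose i := by
  rw [mem_powersetCard] at hT₁ hT₂
  obtain ⟨t, ht⟩ := card_eq_one.1 hd
  have ht' : t ∈ T₁ ∧ t ∉ T₂ := by rw [← mem_sdiff, ht]; exact mem_singleton_self t
  have hsub : powersetCard (i + 1) S ⊆ ((powersetCard (i + 1) S).filter
      (fun X => (X ∩ T₁).Nonempty ∧ (X ∩ T₂).Nonempty) ∪ powersetCard (i + 1) (S \ T₁)) ∪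
        (powersetCard (i + 1) (S \ T₂)).filter (t ∈ ·) := by
    intro X hX
    have hX' := mem_powersetCard.1 hX
    simp only [mem_union, mem_filter, mem_powersetCard]
    by_cases h1 : (X ∩ T₁).Nonempty
    · by_cases h2 : (X ∩ T₂).Nonempty
      · exact Or.inl (Or.inl ⟨hX', h1, h2⟩)
      · rw [not_nonempty_iff_eq_empty, ← disjoint_iff_inter_eq_empty] at h2
        obtain ⟨z, hz⟩ := h1
        rw [mem_inter] at hz
        have hz' : z ∈ T₁ \ T₂ := mem_sdiff.2 ⟨hz.2, disjoint_left.1 h2 hz.1⟩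
        rw [ht, mem_singleton] at hz'
        exact Or.inr ⟨⟨subset_sdiff.2 ⟨hX'.1, h2⟩, hX'.2⟩, hz' ▸ hz.1⟩
    · rw [not_nonempty_iff_eq_empty, ← disjoint_iff_inter_eq_empty] at h1
      exact Or.inl (Or.inr ⟨subset_sdiff.2 ⟨hX'.1, h1⟩, hX'.2⟩)
  have h1 := card_le_card hsub
  have h2 := card_union_le ((powersetCard (i + 1) S).filter
      (fun X => (X ∩ T₁).Nonempty ∧ (X ∩ T₂).Nonempty) ∪ powersetCard (i + 1) (S \ T₁))
        ((powersetCard (i + 1) (S \ T₂)).filter (t ∈ ·))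
  have h3 := card_union_le ((powersetCard (i + 1) S).filter
      (fun X => (X ∩ T₁).Nonempty ∧ (X ∩ T₂).Nonempty)) (powersetCard (i + 1) (S \ T₁))
  rw [card_powersetCard, card_sdiff_of_subset hT₁.1, hT₁.2] at h3
  rw [card_filter_mem_powersetCard_succ (mem_sdiff.2 ⟨hT₁.1 ht'.1, ht'.2⟩),
    card_sdiff_of_subset hT₂.1, hT₂.2] at h2
  rw [card_powersetCard] at h1
  omega

end Extremal

/-! ### The size of `familyJ n k 2` and the permutation onto it. -/

section Isomorphism

variable {n k : ℕ}

/-- The equality pattern of `x` with a point and two sets. -/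
def pattern (c : Fin n) (G₁ G₂ : Finset (Fin n)) (x : Fin n) : Bool × Bool × Bool :=
  (decide (x = c), decide (x ∈ G₁), decide (x ∈ G₂))

theorem card_filter_pattern {c : Fin n} {G₁ G₂ : Finset (Fin n)} (h₁ : c ∉ G₁) (h₂ : c ∉ G₂)
    (k₁ : #G₁ = k) (k₂ : #G₂ = k) (hd : #(G₁ \ G₂) = 1) (b : Bool × Bool × Bool) :
    #(univ.filter (fun x => pattern c G₁ G₂ x = b)) =
      match b with
      | (true, false, false) => 1
      | (true, _, _) => 0
      | (false, true, true) => k - 1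
      | (false, true, false) => 1
      | (false, false, true) => 1
      | (false, false, false) => n - (k + 2) := by
  have hi := card_sdiff_add_card_inter G₁ G₂
  have hi' := card_sdiff_add_card_inter G₂ G₁
  rw [inter_comm] at hi'
  have hu : #(insert c (G₁ ∪ G₂)) = k + 2 := by
    have := card_union_add_card_inter G₁ G₂
    rw [card_insert_of_notMem (by simp [h₁, h₂])]
    omega
  have hk : ∀ {s : Finset (Fin n)} {m : ℕ}, #s = m →
      univ.filter (fun x => pattern c G₁ G₂ x = b) = s →
        #(univ.filter (fun x => pattern c G₁ G₂ x = b)) = m := fun h h' => h' ▸ h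
  obtain ⟨b₁, b₂, b₃⟩ := b
  rcases b₁ with _ | _ <;> rcases b₂ with _ | _ <;> rcases b₃ with _ | _
  · refine hk (s := univ \ insert c (G₁ ∪ G₂)) ?_ ?_
    · rw [card_sdiff_of_subset (subset_univ _), hu, card_univ, Fintype.card_fin]
    · ext x; simp [pattern]
  · refine hk (s := G₂ \ G₁) (by simp only; omega) ?_
    ext x
    simp only [pattern, Prod.mk.injEq, mem_filter, mem_univ, true_and, mem_sdiff,
      decide_eq_true_eq, decide_eq_false_iff_not]
    grind
  · refine hk (s := G₁ \ G₂) hd ?_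
    ext x
    simp only [pattern, Prod.mk.injEq, mem_filter, mem_univ, true_and, mem_sdiff,
      decide_eq_true_eq, decide_eq_false_iff_not]
    grind
  · refine hk (s := G₁ ∩ G₂) (by simp only; omega) ?_
    ext x
    simp only [pattern, Prod.mk.injEq, mem_filter, mem_univ, true_and, mem_inter,
      decide_eq_true_eq, decide_eq_false_iff_not]
    grind
  · refine hk (s := {c}) (by simp) ?_
    ext x
    simp only [pattern, Prod.mk.injEq, mem_filter, mem_univ, true_and, mem_singleton,
      decide_eq_true_eq, decide_eq_false_iff_not]
    grind
  all_goals
    refine hk (s := ∅) (by simp) ?_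
    ext x
    simp only [pattern, Prod.mk.injEq, mem_filter, mem_univ, true_and, notMem_empty,
      decide_eq_true_eq, decide_eq_false_iff_not]
    grind

/-- The fibres of `pattern` have sizes depending only on `n` and `k`, so bijections between
corresponding fibres glue to a permutation. -/
theorem exists_perm_of_card_sdiff_eq_one {c c' : Fin n} {G₁ G₂ G₁' G₂' : Finset (Fin n)}
    (h₁ : c ∉ G₁) (h₂ : c ∉ G₂) (k₁ : #G₁ = k) (k₂ : #G₂ = k) (hd : #(G₁ \ G₂) = 1)
    (h₁' : c' ∉ G₁') (h₂' : c' ∉ G₂') (k₁' : #G₁' = k) (k₂' : #G₂' = k)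
    (hd' : #(G₁' \ G₂') = 1) :
    ∃ σ : Equiv.Perm (Fin n), σ c = c' ∧ (∀ x, σ x ∈ G₁' ↔ x ∈ G₁) ∧ ∀ x, σ x ∈ G₂' ↔ x ∈ G₂ := by
  have e : ∀ b, {x // pattern c G₁ G₂ x = b} ≃ {x // pattern c' G₁' G₂' x = b} := fun b =>
    Fintype.equivOfCardEq (by
      rw [Fintype.card_subtype, Fintype.card_subtype, card_filter_pattern h₁ h₂ k₁ k₂ hd,
        card_filter_pattern h₁' h₂' k₁' k₂' hd'])
  have hσ := Equiv.ofFiberEquiv_map e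
  simp only [pattern, Prod.mk.injEq, decide_eq_decide] at hσ
  exact ⟨Equiv.ofFiberEquiv e, (hσ c).1.2 rfl, fun x => (hσ x).2.1, fun x => (hσ x).2.2⟩

theorem image_perm_eq {σ : Equiv.Perm (Fin n)} {G G' : Finset (Fin n)}
    (h : ∀ x, σ x ∈ G' ↔ x ∈ G) : G.image σ = G' := by
  ext y
  rw [mem_image]
  constructor
  · rintro ⟨x, hx, rfl⟩
    exact (h x).2 hx
  · intro hy
    exact ⟨σ.symm y, by rw [← h, σ.apply_symm_apply]; exact hy, σ.apply_symm_apply y⟩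

theorem card_image_image_perm (σ : Equiv.Perm (Fin n)) (F : Finset (Finset (Fin n))) :
    #(F.image (fun A => A.image σ)) = #F :=
  card_image_of_injective _ (image_injective σ.injective)

theorem card_groundInterval {a b : ℕ} (ha : 1 ≤ a) (hb : b ≤ n) :
    #(groundInterval n a b) = b + 1 - a := by
  rw [← Nat.card_Icc]
  refine card_bij (fun x _ => (x : ℕ) + 1) ?_ ?_ ?_
  · intro x hx
    exact mem_Icc.2 (mem_filter.1 hx).2
  · intro x _ y _ hxy
    exact Fin.ext (by omega)
  · intro y hy
    rw [mem_Icc] at hy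
    exact ⟨⟨y - 1, by omega⟩, mem_filter.2 ⟨mem_univ _, by simp only; omega⟩, by simp only; omega⟩

theorem card_intervalSet_one_sdiff (hk : 1 ≤ k) (hn : 1 < n) :
    #(intervalSet n k 1 \ intervalSet n k 2) = 1 := by
  rw [card_eq_one]
  refine ⟨⟨1, hn⟩, ?_⟩
  ext x
  simp only [intervalSet, groundInterval, mem_sdiff, mem_filter, mem_univ, true_and,
    mem_singleton, Fin.ext_iff]
  omega

theorem intervalSet_mem_powersetCard {i : ℕ} {c : Fin n} (hc : (c : ℕ) = 0) (hi : 1 ≤ i)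
    (hn : k + i ≤ n) : intervalSet n k i ∈ powersetCard k (univ.erase c) := by
  rw [mem_powersetCard, intervalSet, card_groundInterval (by omega) hn]
  refine ⟨fun x hx => mem_erase.2 ⟨?_, mem_univ _⟩, by omega⟩
  rintro rfl
  have := (mem_filter.1 hx).2
  omega

theorem card_familyJ_two {p : ℕ} (hn : p + 4 ≤ n) :
    #(familyJ n (p + 2) 2) + (n - (p + 3)).choose (p + 1) + (n - (p + 3) - 1).choose p =
      (n - 1).choose (p + 1) + 2 := by
  set c : Fin n := ⟨0, by omega⟩ with hcdef
  have hI₁ := intervalSet_mem_powersetCard (n := n) (k := p + 2) (c := c) (i := 1) rfl le_rfl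
    (by omega)
  have hI₂ := intervalSet_mem_powersetCard (n := n) (k := p + 2) (c := c) (i := 2) rfl
    (by omega) (by omega)
  have hd := card_intervalSet_one_sdiff (n := n) (k := p + 2) (by omega) (by omega)
  have hne : intervalSet n (p + 2) 1 ≠ intervalSet n (p + 2) 2 := by
    intro h
    rw [h, sdiff_self] at hd
    simp at hd
  -- The two opposite estimates together give the exact number of sets in `M`, the links at `c` of
  -- the members of `familyJ` through `c`.
  have hM := choose_le_card_filter_meets (i := p) hI₁ hI₂ hd
  have hM' := card_add_choose_add_choose_le_of_meets (i := p) (filter_subset (fun X =>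
    (X ∩ intervalSet n (p + 2) 1).Nonempty ∧ (X ∩ intervalSet n (p + 2) 2).Nonempty) _) hI₁ hI₂
    hne (fun X hX => (mem_filter.1 hX).2.1) fun X hX => (mem_filter.1 hX).2.2
  rw [card_erase_of_mem (mem_univ c), card_univ, Fintype.card_fin,
    show n - 1 - (p + 2) = n - (p + 3) by omega] at hM hM'
  set M := (powersetCard (p + 1) (univ.erase c)).filter (fun X =>
    (X ∩ intervalSet n (p + 2) 1).Nonempty ∧ (X ∩ intervalSet n (p + 2) 2).Nonempty) with hMdef
  have hcM : ∀ X ∈ M, c ∉ X := fun X hX h =>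
    notMem_erase c univ ((mem_powersetCard.1 (mem_filter.1 hX).1).1 h)
  have hc1 : c ∉ intervalSet n (p + 2) 1 := fun h =>
    notMem_erase c univ ((mem_powersetCard.1 hI₁).1 h)
  have hc2 : c ∉ intervalSet n (p + 2) 2 := fun h =>
    notMem_erase c univ ((mem_powersetCard.1 hI₂).1 h)
  have hJ : familyJ n (p + 2) 2 =
      {intervalSet n (p + 2) 1, intervalSet n (p + 2) 2} ∪ M.image (insert c) := by
    refine congrArg _ (Subset.antisymm (fun X hX => ?_) fun X hX => ?_)
    · obtain ⟨h1, ⟨x, hx, hx0⟩, h2, h3⟩ := mem_filter.1 hX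
      rw [show x = c from Fin.ext (by simpa using hx0)] at hx
      have hinter : ∀ I : Finset (Fin n), c ∉ I → (X ∩ I).Nonempty →
          (X.erase c ∩ I).Nonempty := by
        rintro I hI ⟨z, hz⟩
        rw [mem_inter] at hz
        exact ⟨z, mem_inter.2 ⟨mem_erase.2 ⟨fun h => hI (h ▸ hz.2), hz.1⟩, hz.2⟩⟩
      refine mem_image.2 ⟨X.erase c, mem_filter.2 ⟨mem_powersetCard.2
        ⟨erase_subset_erase c (subset_univ X), ?_⟩, hinter _ hc1 h2, hinter _ hc2 h3⟩,
        insert_erase hx⟩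
      rw [card_erase_of_mem hx, (mem_powersetCard.1 h1).2]
      rfl
    · obtain ⟨Y, hY, rfl⟩ := mem_image.1 hX
      obtain ⟨h1, h2, h3⟩ := mem_filter.1 hY
      refine mem_filter.2 ⟨mem_powersetCard.2 ⟨subset_univ _, ?_⟩,
        ⟨c, mem_insert_self _ _, rfl⟩, h2.mono ?_, h3.mono ?_⟩
      · rw [card_insert_of_notMem (hcM Y hY), (mem_powersetCard.1 h1).2]
      · exact inter_subset_inter_right (subset_insert _ _)
      · exact inter_subset_inter_right (subset_insert _ _)
  have hdis : Disjoint {intervalSet n (p + 2) 1, intervalSet n (p + 2) 2} (M.image (insert c)) := by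
    rw [disjoint_left]
    intro X hX hX'
    obtain ⟨Y, hY, rfl⟩ := mem_image.1 hX'
    rcases mem_insert.1 hX with h | h
    · exact hc1 (h ▸ mem_insert_self _ _)
    · exact hc2 (mem_singleton.1 h ▸ mem_insert_self _ _)
  have hinj : Set.InjOn (insert c) (M : Set (Finset (Fin n))) := by
    intro X hX Y hY hXY
    rw [← erase_insert (hcM X hX), ← erase_insert (hcM Y hY)]
    exact congrArg (fun Z => Z.erase c) hXY
  rw [hJ, card_union_of_disjoint hdis, card_pair hne, card_image_of_injOn hinj]
  omega

theorem two_le_card_nonMemberSubfamily {F : Finset (Finset (Fin n))} (h : 2 ≤ diversity F)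
    (c : Fin n) : 2 ≤ #(F.nonMemberSubfamily c) := by
  have h1 : familyDegree F c ≤ familyMaxDegree F := le_sup (mem_univ c)
  have h2 : familyDegree F c + #(F.nonMemberSubfamily c) = #F :=
    card_filter_add_card_filter_not (s := F) (fun A => c ∈ A)
  rw [diversity] at h
  omega

theorem CrossIntersecting.card_add_choose_le_of_card_nonMemberSubfamily {p : ℕ}
    {F : Finset (Finset (Fin n))} {c : Fin n} (hn : 2 * (p + 4) < n)
    (hF : F ⊆ powersetCard (p + 4) univ) (h : CrossIntersecting F F)
    (hc : #(F.nonMemberSubfamily c) = 2) :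
    #F + (n - (p + 5)).choose (p + 3) + (n - (p + 5) - 1).choose (p + 2) ≤
        (n - 1).choose (p + 3) + 2 ∧
      (#F + (n - (p + 5)).choose (p + 3) + (n - (p + 5) - 1).choose (p + 2) =
        (n - 1).choose (p + 3) + 2 → #(familyJ n (p + 4) 2) ≤ #F →
          FamilyIsomorphic F (familyJ n (p + 4) 2)) := by
  have hi : insert c (univ.erase c) = (univ : Finset (Fin n)) := insert_erase (mem_univ c)
  have hcard : #(univ.erase c) = n - 1 := by
    rw [card_erase_of_mem (mem_univ c), card_univ, Fintype.card_fin]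
  have hH : F.memberSubfamily c ⊆ powersetCard (p + 3) (univ.erase c) :=
    memberSubfamily_subset_powersetCard (by rwa [hi])
  have hT : F.nonMemberSubfamily c ⊆ powersetCard (p + 4) (univ.erase c) :=
    nonMemberSubfamily_subset_powersetCard (by rwa [hi])
  have hx : CrossIntersecting (F.memberSubfamily c) (F.nonMemberSubfamily c) := h.member_nonMember
  have h1 : #(F.memberSubfamily c) + (#(univ.erase c) - (p + 4)).choose (p + 3) +
      (#(univ.erase c) - (p + 4) - 1).choose (p + 2) ≤ (#(univ.erase c)).choose (p + 3) :=
    hx.card_add_choose_add_choose_le hH hT hc.ge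
  have hs := card_memberSubfamily_add_card_nonMemberSubfamily c F
  rw [hcard, show n - 1 - (p + 4) = n - (p + 5) by omega] at h1
  refine ⟨by omega, fun heq hJ => ?_⟩
  obtain ⟨G₁, G₂, hne, hG⟩ := card_eq_two.1 hc
  have hG₁ : G₁ ∈ F.nonMemberSubfamily c := by rw [hG]; simp
  have hG₂ : G₂ ∈ F.nonMemberSubfamily c := by rw [hG]; simp
  have k₁ := (mem_powersetCard.1 (hT hG₁)).2
  have k₂ := (mem_powersetCard.1 (hT hG₂)).2
  have hd : #(G₁ \ G₂) = 1 := by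
    obtain ⟨t, ht1, ht2⟩ := exists_mem_notMem_of_card_eq hne (k₁.trans k₂.symm)
    have hpos := card_pos.2 ⟨t, mem_sdiff.2 ⟨ht1, ht2⟩⟩
    by_contra hcon
    have h2 : #(F.memberSubfamily c) + (#(univ.erase c) - (p + 4)).choose (p + 3) +
        (#(univ.erase c) - (p + 4) - 1).choose (p + 2) < (#(univ.erase c)).choose (p + 3) :=
      card_add_choose_add_choose_lt_of_card_sdiff hH (hT hG₁) (hT hG₂)
      (by omega) (by omega) (fun X hX => hx X hX _ hG₁) fun X hX => hx X hX _ hG₂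
    rw [hcard, show n - 1 - (p + 4) = n - (p + 5) by omega] at h2
    omega
  set c' : Fin n := ⟨0, by omega⟩ with hc'
  have hI₁ := mem_powersetCard.1 (intervalSet_mem_powersetCard (n := n) (k := p + 4) (c := c')
    (i := 1) rfl le_rfl (by omega))
  have hI₂ := mem_powersetCard.1 (intervalSet_mem_powersetCard (n := n) (k := p + 4) (c := c')
    (i := 2) rfl (by omega) (by omega))
  obtain ⟨σ, hσc, hσ₁, hσ₂⟩ := exists_perm_of_card_sdiff_eq_one
    (mem_nonMemberSubfamily.1 hG₁).2 (mem_nonMemberSubfamily.1 hG₂).2 k₁ k₂ hd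
    (fun h => notMem_erase c' univ (hI₁.1 h)) (fun h => notMem_erase c' univ (hI₂.1 h))
    hI₁.2 hI₂.2 (card_intervalSet_one_sdiff (n := n) (k := p + 4) (by omega) (by omega))
  -- Inclusion in `familyJ` is enough, since `F` is at least as large.
  refine ⟨σ, eq_of_subset_of_card_le ?_ (by rwa [card_image_image_perm])⟩
  intro Y hY
  obtain ⟨X, hX, rfl⟩ := mem_image.1 hY
  by_cases hcX : c ∈ X
  · have hmeet : ∀ G ∈ F, ∀ I : Finset (Fin n), (∀ x, σ x ∈ I ↔ x ∈ G) →
        (X.image σ ∩ I).Nonempty := by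
      intro G hG I hI
      obtain ⟨z, hz⟩ := h X hX G hG
      rw [mem_inter] at hz
      exact ⟨σ z, mem_inter.2 ⟨mem_image_of_mem σ hz.1, (hI z).2 hz.2⟩⟩
    refine mem_union_right _ (mem_filter.2 ⟨mem_powersetCard.2 ⟨subset_univ _, ?_⟩,
      ⟨c', hσc ▸ mem_image_of_mem σ hcX, rfl⟩, hmeet _ (nonMemberSubfamily_subset hG₁) _ hσ₁,
      hmeet _ (nonMemberSubfamily_subset hG₂) _ hσ₂⟩)
    rw [card_image_of_injective _ σ.injective, (mem_powersetCard.1 (hF hX)).2]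
  · have hXG : X ∈ F.nonMemberSubfamily c := mem_nonMemberSubfamily.2 ⟨hX, hcX⟩
    rw [hG, mem_insert, mem_singleton] at hXG
    refine mem_union_left _ (mem_insert.2 ?_)
    rcases hXG with rfl | rfl
    · exact Or.inl (image_perm_eq hσ₁)
    · exact Or.inr (mem_singleton.2 (image_perm_eq hσ₂))

end Isomorphism

/-! ### The theorem, split by whether every point is avoided by three members. -/

theorem mainTheorem9 (n k : ℕ) (hk : 4 ≤ k) (hn : 2 * k < n)
    (F : Finset (Finset (Fin n)))
    (hF : ∀ A ∈ F, A.card = k)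
    (hint : ∀ A ∈ F, ∀ B ∈ F, (A ∩ B).Nonempty)
    (hdiv : 2 ≤ diversity F) :
    (F.card : ℤ) ≤ ((n - 1).choose (k - 1) : ℤ) - ((n - k - 1).choose (k - 1) : ℤ)
        - ((n - k - 2).choose (k - 2) : ℤ) + 2 ∧
      (5 ≤ k →
        ((F.card : ℤ) = ((n - 1).choose (k - 1) : ℤ) - ((n - k - 1).choose (k - 1) : ℤ)
            - ((n - k - 2).choose (k - 2) : ℤ) + 2 ↔
          FamilyIsomorphic F (familyJ n k 2))) := by
  obtain ⟨p, rfl⟩ := Nat.exists_eq_add_of_le' hk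
  rw [show n - (p + 4) - 1 = n - (p + 5) by omega, show p + 4 - 1 = p + 3 by omega,
    show n - (p + 4) - 2 = n - (p + 5) - 1 by omega, show p + 4 - 2 = p + 2 by omega]
  have hFk : F ⊆ powersetCard (p + 4) univ := fun A hA =>
    mem_powersetCard.2 ⟨subset_univ A, hF A hA⟩
  have hdiv2 := two_le_card_nonMemberSubfamily hdiv
  have hJ : #(familyJ n (p + 4) 2) + (n - (p + 5)).choose (p + 3) +
      (n - (p + 5) - 1).choose (p + 2) = (n - 1).choose (p + 3) + 2 :=
    card_familyJ_two (p := p + 2) (by omega)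
  have hiso : FamilyIsomorphic F (familyJ n (p + 4) 2) → #F = #(familyJ n (p + 4) 2) := by
    rintro ⟨σ, hσ⟩
    rw [← hσ, card_image_image_perm]
  by_cases h3 : ∀ c, 3 ≤ #(F.nonMemberSubfamily c)
  · have hb := CrossIntersecting.card_add_choose_add_choose_le_of_three_le hn hFk hint h3
    refine ⟨by omega, fun h5 => ⟨fun heq => ?_, fun hf => ?_⟩⟩
    -- Here the bound is strict for `k ≥ 5`, so equality is contradictory; conversely, an
    -- isomorphism would give `F` the size of `familyJ`, which attains the bound.
    · have := hb.2 (by omega)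
      omega
    · have := hiso hf
      omega
  · push Not at h3
    obtain ⟨c, hc⟩ := h3
    have hb := CrossIntersecting.card_add_choose_le_of_card_nonMemberSubfamily hn hFk hint
      (show #(F.nonMemberSubfamily c) = 2 by have := hdiv2 c; omega)
    refine ⟨by omega, fun _ => ⟨fun heq => hb.2 (by omega) (by omega), fun hf => ?_⟩⟩
    have := hiso hf
    omega
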